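/- Consider the quantum hydrodynamics system $\rho_t+m_x=0$, $m_t+(m^2/\rho+\rho^\gamma)_x=\epsilon\mu m_{xx}+\epsilon^2k^2\rho\big((\sqrt\rho)_{xx}/\sqrt\rho\big)_x$ with $\gamma\ge 1$, $0<\mu<2$ and $k=\sqrt2$. Let $(P,J)$ be a travelling wave profile of speed $s\in\mathbb R$: $P\in C^3$, $J\in C^2$, $P>0$, $$-sP'+J'=0,\qquad -sJ'+\Big(\frac{J^2}{P}+P^\gamma\Big)'=\mu J''+\frac{k^2}{2}\big(P(\ln P)''\big)',$$ with $P\to P^\pm>0$, $J\to J^\pm$, $P'\to0$ at $\pm\infty$. Put $$f_1=\frac{J^2}{P^2}-\gamma P^{\gamma-1},\quad f_2=s-\frac{2J}{P},\quad f_3=k^2\Big(\frac{P'P''}{P^2}-\Big(\frac{P'}{P}\Big)^3\Big),\quad f_4=k^2\Big(\frac32\Big(\frac{P'}{P}\Big)^2-\frac{P''}{P}\Big),\quad f_5=-k^2\frac{P'}{P},$$ and consider the scalar eigenvalue equation in the integrated density $\hat\rho$ (with $2/k^2=1$) $$\hat\rho''''+(s\mu+f_5)\hat\rho'''+(f_1+sf_2+f_4-\lambda\mu)\hat\rho''+(f_1'+sf_2'-\lambda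 f_2+f_3-s\lambda)\hat\rho'+(\lambda^2-\lambda f_2')\hat\rho=0,\tag{1}$$ written as a first-order system $Y'=M(x,\lambda)Y$ for $Y=(\hat\rho,\hat\rho',\hat\rho'',\hat\rho''')$. Its Evans function is $E(\lambda)=\det\big(Y_1^-(0),Y_2^-(0),Y_1^+(0),Y_2^+(0)\big)$, where $Y_1^\pm,Y_2^\pm$ is a basis of the space of solutions that tend to $0$ at $\pm\infty$; it is determined up to a non-zero factor. In particular one may take $Y_i^\pm$ normalized by $e^{-\nu_i^\pm x}Y_i^\pm(x)\to v_i^\pm$ as $x\to\pm\infty$, if such solutions exist, where $v_1^\pm,v_2^\pm$ are linearly independent eigenvectors of $M^\pm(\lambda)=\lim_{x\to\pm\infty}M(x,\lambda)$ for eigenvalues $\nu_i^\pm$ with $\operatorname{Re}\nu_i^-> 0$ and $\operatorname{Re}\nu_i^+<0$. Let $\theta_{1,2}=\arg\big(\frac\mu2\pm i\sqrt{1-\mu^2/4}\big)$, $\alpha=\operatorname{Re}\,e^{i(\pi/2+\theta_1)/2}$, $z_{1,3}=\mp e^{i\theta_1/2}$, $z_{2,4}=\mp e^{i\theta_2/2}$,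 $g_j=\prod_{l\ne j}|z_j-z_l|$. For $a>0$ and a half-line $S$ put $$m_1=a^{-1}\sup_S|f_2'|,\quad m_2=a^{-3/2}\sup_S|f_1'+sf_2'+f_3|+a^{-1/2}\sup_S|f_2+s|,\quad m_3=a^{-1}\sup_S|f_1+sf_2+f_4|,\quad m_4=a^{-1/2}\sup_S|s\mu+f_5|,$$ $p_j=\sum_{l=1}^4m_l|z_j|^{l-1}=\sum_{l=1}^4 m_l$. Let $\delta_+(a)$ (with $S=[0,\infty)$) and $\delta_-(a)$ (with $S=(-\infty,0]$) be the Frobenius norms of the matrices $R_\pm=(p_l/g_j)_{j,l}$, and let $\epsilon_\pm(a)=4\alpha^{-1}\delta_\pm(a)$. Suppose that for some $C>0$ one has $\delta_\pm(C)<\alpha/4$ and $\sqrt2\,\sqrt{\epsilon_+(C)^2+\epsilon_-(C)^2}<1$. Then for every $\lambda\in\mathbb C$ with $\operatorname{Re}\lambda\ge0$ and $|\lambda|\ge C$, the spaces of solutions of (1) decaying at $-\infty$ and at $+\infty$ are both two-dimensional (so the Evans function is defined) and $E(\lambda)\ne0$, for every choice of the bases and for every choice of normalized solutions. Consequently no such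 $\lambda$ is an eigenvalue, on $L^2\times L^2$ with domain $H^3\times H^2$, of the linearization about the profile $$\lambda\tilde\rho=s\tilde\rho'-\tilde J',\qquad \lambda\tilde J=s\tilde J'+\Big(\frac{J^2}{P^2}\tilde\rho\Big)'-\Big(\frac{2J}{P}\tilde J\Big)'-\gamma\big(P^{\gamma-1}\tilde\rho\big)'+\mu\tilde J''+\frac{k^2}{2}\tilde\rho'''-2k^2\Big((\sqrt P)'\Big(\frac{\tilde\rho}{\sqrt P}\Big)'\Big)'.$$ -/

import Mathlib

open Filter Topology MeasureTheory
open scoped ContDiff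

noncomputable section

/-- A travelling wave profile `(P, J)` with speed `s` for the quantum hydrodynamics system with
pressure exponent `γ`, viscosity `μ` and dispersion `k`: a classical solution of the profile
equations with positive density, connecting the end states `(Pm, Jm)` at `-∞` and `(Pp, Jp)`
at `+∞` (in the phase plane `(P, P')`, the orbit joins `(Pm, 0)` to `(Pp, 0)`). -/
structure ShockProfile (γ μ k s : ℝ) where
  P : ℝ → ℝ
  J : ℝ → ℝ
  Pm : ℝ
  Pp : ℝ
  Jm : ℝ
  Jp : ℝ
  contDiff_P : ContDiff ℝ 3 P
  contDiff_J : ContDiff ℝ 2 J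
  pos : ∀ y, 0 < P y
  Pm_pos : 0 < Pm
  Pp_pos : 0 < Pp
  mass : ∀ y, -s * deriv P y + deriv J y = 0
  momentum : ∀ y,
    -s * deriv J y + deriv (fun x => J x ^ 2 / P x + P x ^ γ) y
      = μ * deriv (deriv J) y
        + k ^ 2 / 2 * deriv (fun x => P x * deriv (deriv (fun t => Real.log (P t))) x) y
  tendsto_P_bot : Tendsto P atBot (𝓝 Pm)
  tendsto_P_top : Tendsto P atTop (𝓝 Pp)
  tendsto_J_bot : Tendsto J atBot (𝓝 Jm)
  tendsto_J_top : Tendsto J atTop (𝓝 Jp)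
  tendsto_deriv_P_bot : Tendsto (deriv P) atBot (𝓝 0)
  tendsto_deriv_P_top : Tendsto (deriv P) atTop (𝓝 0)

/-! ### Linear systems on the line and the Evans determinant -/

/-- The solutions `Y` of `Y' = M(x) Y` on the whole line that tend to `0` along `l`
(used with `l = atBot` and `l = atTop`). -/
def decaySpace (M : ℝ → Matrix (Fin 4) (Fin 4) ℂ) (l : Filter ℝ) :
    Submodule ℂ (ℝ → Fin 4 → ℂ) where
  carrier := {Y | (∀ x, HasDerivAt Y ((M x).mulVec (Y x)) x) ∧ Tendsto Y l (𝓝 0)}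
  zero_mem' := by
    refine ⟨fun x => ?_, tendsto_const_nhds⟩
    rw [Pi.zero_apply, Matrix.mulVec_zero]
    exact hasDerivAt_const x (0 : Fin 4 → ℂ)
  add_mem' := by
    rintro Y Z ⟨hY, hY0⟩ ⟨hZ, hZ0⟩
    refine ⟨fun x => ?_, ?_⟩
    · simpa [Matrix.mulVec_add] using (hY x).add (hZ x)
    · have h := hY0.add hZ0
      rw [add_zero] at h
      exact h
  smul_mem' := by
    rintro c Y ⟨hY, hY0⟩
    refine ⟨fun x => ?_, ?_⟩
    · simpa [Matrix.mulVec_smul] using (hY x).const_smul c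
    · have h := hY0.const_smul c
      rw [smul_zero] at h
      exact h

/-- `Y 0, Y 1` is a basis of the solutions decaying at `-∞`, and `Y 2, Y 3` is a basis of the
solutions decaying at `+∞`. -/
structure IsEvansFrame (M : ℝ → Matrix (Fin 4) (Fin 4) ℂ) (Y : Fin 4 → ℝ → Fin 4 → ℂ) :
    Prop where
  linearIndependent_bot : LinearIndependent ℂ ![Y 0, Y 1]
  span_bot : Submodule.span ℂ {Y 0, Y 1} = decaySpace M atBot
  linearIndependent_top : LinearIndependent ℂ ![Y 2, Y 3]
  span_top : Submodule.span ℂ {Y 2, Y 3} = decaySpace M atTop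

/-- Evans solutions normalized by their asymptotics: `Y 0, Y 1` are solutions with
`exp (-ν x) Y(x) → v` at `-∞`, where `v` runs through independent eigenvectors of the limit
matrix `Mm` with eigenvalues `ν` of positive real part; `Y 2, Y 3` are solutions with the same
property at `+∞`, for independent eigenvectors of `Mp` with eigenvalues of negative real part. -/
structure IsNormalizedEvansFrame (M : ℝ → Matrix (Fin 4) (Fin 4) ℂ)
    (Mm Mp : Matrix (Fin 4) (Fin 4) ℂ) (ν : Fin 4 → ℂ) (v : Fin 4 → Fin 4 → ℂ)
    (Y : Fin 4 → ℝ → Fin 4 → ℂ) : Prop where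
  solution : ∀ i x, HasDerivAt (Y i) ((M x).mulVec (Y i x)) x
  eigen_bot : ∀ i ∈ ({0, 1} : Set (Fin 4)), Mm.mulVec (v i) = ν i • v i ∧ 0 < (ν i).re
  eigen_top : ∀ i ∈ ({2, 3} : Set (Fin 4)), Mp.mulVec (v i) = ν i • v i ∧ (ν i).re < 0
  linearIndependent_bot : LinearIndependent ℂ ![v 0, v 1]
  linearIndependent_top : LinearIndependent ℂ ![v 2, v 3]
  tendsto_bot : ∀ i ∈ ({0, 1} : Set (Fin 4)),
    Tendsto (fun x : ℝ => Complex.exp (-ν i * x) • Y i x) atBot (𝓝 (v i))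
  tendsto_top : ∀ i ∈ ({2, 3} : Set (Fin 4)),
    Tendsto (fun x : ℝ => Complex.exp (-ν i * x) • Y i x) atTop (𝓝 (v i))

/-- The value `det (Y₁⁻(0), Y₂⁻(0), Y₁⁺(0), Y₂⁺(0))` of the Evans function. -/
def evansDet (Y : Fin 4 → ℝ → Fin 4 → ℂ) : ℂ :=
  Matrix.det (Matrix.of fun i j : Fin 4 => Y j 0 i)

/-- The first-order system of `u'''' + a₃ u''' + a₂ u'' + a₁ u' + a₀ u = 0` for
`(u, u', u'', u''')`. -/
def companion4 (a₀ a₁ a₂ a₃ : ℂ) : Matrix (Fin 4) (Fin 4) ℂ :=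
  !![0, 1, 0, 0;
     0, 0, 1, 0;
     0, 0, 0, 1;
     -a₀, -a₁, -a₂, -a₃]

namespace ShockProfile

variable {γ μ k s : ℝ} (W : ShockProfile γ μ k s)

/-! ### Coefficients of the linearization about the profile -/

def f₁ (x : ℝ) : ℝ := W.J x ^ 2 / W.P x ^ 2 - γ * W.P x ^ (γ - 1)

def f₂ (x : ℝ) : ℝ := s - 2 * (W.J x / W.P x)

def f₃ (x : ℝ) : ℝ :=
  k ^ 2 * (deriv W.P x * deriv (deriv W.P) x / W.P x ^ 2 - (deriv W.P x / W.P x) ^ 3)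

def f₄ (x : ℝ) : ℝ :=
  k ^ 2 * (3 / 2 * (deriv W.P x / W.P x) ^ 2 - deriv (deriv W.P) x / W.P x)

def f₅ (x : ℝ) : ℝ := -k ^ 2 * (deriv W.P x / W.P x)

/-- The first-order form of the scalar fourth-order eigenvalue equation in the integrated
density. -/
def scalarSystem (lam : ℂ) (x : ℝ) : Matrix (Fin 4) (Fin 4) ℂ :=
  companion4
    (2 / k ^ 2 * (-lam * deriv W.f₂ x + lam ^ 2))
    (2 / k ^ 2 * (deriv W.f₁ x + deriv W.f₂ x * s - lam * W.f₂ x + W.f₃ x - s * lam))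
    (2 / k ^ 2 * (W.f₁ x + W.f₂ x * s + W.f₄ x - lam * μ))
    (2 / k ^ 2 * (s * μ + W.f₅ x))

/-- The constant coefficient system obtained from `scalarSystem` at an end state with density `p`
and momentum `q`. -/
def endStateSystem (γ μ k s p q : ℝ) (lam : ℂ) : Matrix (Fin 4) (Fin 4) ℂ :=
  companion4
    (2 / k ^ 2 * lam ^ 2)
    (2 / k ^ 2 * (-lam * (s - 2 * (q / p) : ℝ) - s * lam))
    (2 / k ^ 2 * ((q ^ 2 / p ^ 2 - γ * p ^ (γ - 1) : ℝ) + (s - 2 * (q / p) : ℝ) * s - lam * μ))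
    (2 / k ^ 2 * (s * μ))

/-- `lam` is an eigenvalue of the operator linearized about the profile, acting in `L² × L²` with
domain `H³ × H²` (eigenfunctions are classical solutions, as the coefficients are continuous). -/
def IsEigenvalue (lam : ℂ) : Prop :=
  ∃ r j : ℝ → ℂ,
    ContDiff ℝ 3 r ∧ ContDiff ℝ 2 j ∧
    (∀ i ≤ 3, MemLp (iteratedDeriv i r) 2 volume) ∧
    (∀ i ≤ 2, MemLp (iteratedDeriv i j) 2 volume) ∧
    (r ≠ 0 ∨ j ≠ 0) ∧
    (∀ x, lam * r x = s * deriv r x - deriv j x) ∧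
    (∀ x, lam * j x =
      s * deriv j x
        + deriv (fun y => ((W.J y ^ 2 / W.P y ^ 2 : ℝ) : ℂ) * r y) x
        - deriv (fun y => ((2 * W.J y / W.P y : ℝ) : ℂ) * j y) x
        - γ * deriv (fun y => ((W.P y ^ (γ - 1) : ℝ) : ℂ) * r y) x
        + μ * deriv (deriv j) x
        + ((k : ℂ) ^ 2 / 2 * deriv (deriv (deriv r)) x
          - 2 * (k : ℂ) ^ 2 * deriv (fun y =>
              ((deriv (fun t => √(W.P t)) y : ℝ) : ℂ)
                * deriv (fun t => r t / ((√(W.P t) : ℝ) : ℂ)) y) x))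

end ShockProfile

/-! ### The explicit constants, for `k = √2` -/

def theta₁ (μ : ℝ) : ℝ := Complex.arg (μ / 2 + Complex.I * (√(1 - μ ^ 2 / 4) : ℝ))

def theta₂ (μ : ℝ) : ℝ := Complex.arg (μ / 2 - Complex.I * (√(1 - μ ^ 2 / 4) : ℝ))

/-- The constant `α`. -/
def alphaConst (μ : ℝ) : ℝ :=
  (Complex.exp (Complex.I * (Real.pi / 2 + theta₁ μ) / 2)).re

/-- The roots `z₁, z₂, z₃, z₄` in the direction `exp (i θ)` of the spectral parameter. -/
def zRoot (μ θ : ℝ) : Fin 4 → ℂ :=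
  ![-Complex.exp (Complex.I * (θ + theta₁ μ) / 2),
    -Complex.exp (Complex.I * (θ + theta₂ μ) / 2),
    Complex.exp (Complex.I * (θ + theta₁ μ) / 2),
    Complex.exp (Complex.I * (θ + theta₂ μ) / 2)]

/-- The products `g_j` of the distances of `z_j` to the other roots; the distances do not depend on
`θ` and are computed at `θ = 0`. -/
def gProd (μ : ℝ) (j : Fin 4) : ℝ :=
  ∏ l ∈ Finset.univ.erase j, ‖zRoot μ 0 j - zRoot μ 0 l‖

/-- The supremum of `|g|` over `S`. -/
def supAbs (S : Set ℝ) (g : ℝ → ℝ) : ℝ := ⨆ x : S, |g x|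

namespace ShockProfile

variable {γ μ k s : ℝ} (W : ShockProfile γ μ k s)

/-- The bounds `m₁, …, m₄` at `|λ| = a`, with suprema over the half-line `S`. -/
def mBound (S : Set ℝ) (a : ℝ) : Fin 4 → ℝ :=
  ![a ^ (-1 : ℝ) * supAbs S (deriv W.f₂),
    a ^ (-(3 / 2) : ℝ) * supAbs S (fun x => deriv W.f₁ x + s * deriv W.f₂ x + W.f₃ x)
      + a ^ (-(1 / 2) : ℝ) * supAbs S (fun x => W.f₂ x + s),
    a ^ (-1 : ℝ) * supAbs S (fun x => W.f₁ x + s * W.f₂ x + W.f₄ x),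
    a ^ (-(1 / 2) : ℝ) * supAbs S (fun x => s * μ + W.f₅ x)]

/-- The matrix `R = (p_k / g_j)`. -/
def residualMatrix (S : Set ℝ) (a : ℝ) : Matrix (Fin 4) (Fin 4) ℝ :=
  Matrix.of fun j i => (∑ l : Fin 4, W.mBound S a l * ‖zRoot μ 0 i‖ ^ (l : ℕ)) / gProd μ j

/-- The Frobenius norm `δ` of the matrix `R`. -/
def deltaConst (S : Set ℝ) (a : ℝ) : ℝ :=
  √(∑ j : Fin 4, ∑ i : Fin 4, W.residualMatrix S a j i ^ 2)

/-- `ε = 4 α⁻¹ δ`. -/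
def epsConst (S : Set ℝ) (a : ℝ) : ℝ := 4 * (alphaConst μ)⁻¹ * W.deltaConst S a

end ShockProfile

end

/-!
The proof replaces the exponential dichotomies of the asymptotic analysis by one indefinite
quadratic form. For `2 / k² = 1` the leading part of the eigenvalue equation at the spectral
parameter `λ` is
`z⁴ - λ μ z² + λ²`; its roots are `± ζ, ± η` with `|ζ| = |η| = √|λ|`, and for `Re λ ≥ 0` the real
parts of `ζ` and `η` are at least `√|λ| α` (`exists_biquadratic_roots`). In the coordinates
`w = L u` that diagonalize the leading part (`modeMatrix`), the remaining coefficients form a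
matrix whose Frobenius norm is at most `√|λ| δ±(C)` on the two half-lines
(`ShockProfile.sqrt_sum_perturbation_le`). The suprema in `δ±` are genuine, since `P''` is bounded
by the first integral of the momentum equation (`ShockProfile.exists_first_integral`). Hence, if
`δ± < α`, the form `q = |w₂|² + |w₃|² - |w₀|² - |w₁|²` satisfies `(q ∘ Y)' ≥ c ‖Y‖²` with `c > 0`
along every solution on the whole line (`ShockProfile.exists_isLyapunovForm_scalarSystem`).

This one inequality has two consequences. Along a solution decaying at `+∞` the form is nonpositive,
along a solution decaying at `-∞` it is nonnegative, and a solution decaying at both ends vanishes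
(`IsLyapunovForm.eq_zero_of_mem_of_mem`); so the two decay spaces are transversal at `0` and the
Evans determinant of bases is nonzero. Conversely a solution with nonpositive form on `[0, ∞)` is
square integrable there and decays; such solutions exist for every stable component of the initial
value, by shooting from `x = n` and passing to a limit, and therefore both decay spaces have
dimension two (`finrank_decaySpace_of_modeForm`).

Normalized solutions decay and are linearly independent because their limit vectors are
(`linearIndependent_of_exp_smul`). Finally, for an eigenfunction `(r, j)` the function
`(s r - j) / λ` is a square integrable primitive of `r` which solves the scalar equation and decays
at both ends (`ShockProfile.IsEigenvalue.exists_mem_decaySpace`), so it is zero.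
-/

noncomputable section

/-! ### Global solutions of Lipschitz differential equations -/

section GlobalExistence

variable {E : Type*} [NormedAddCommGroup E] [NormedSpace ℝ E]

theorem hasDerivAt_ite_le {y z : ℝ → E} {d : E} {t : ℝ} (hyz : y t = z t)
    (hy : HasDerivAt y d t) (hz : HasDerivAt z d t) :
    HasDerivAt (fun r => if r ≤ t then y r else z r) d t := by
  rw [← hasDerivWithinAt_univ, ← Set.Iic_union_Ici (a := t)]
  refine HasDerivWithinAt.union ?_ ?_
  · exact hy.hasDerivWithinAt.congr (fun r hr => if_pos hr) (if_pos le_rfl)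
  · refine hz.hasDerivWithinAt.congr (fun r hr => ?_) ?_
    · rcases eq_or_lt_of_le (show t ≤ r from hr) with h | h
      · rw [← h]; simp [hyz]
      · rw [if_neg (not_le.2 h)]
    · simp [hyz]

/-- Two solutions that agree at `t₁` are joined there. -/
theorem hasDerivAt_glue {v : ℝ → E → E} {y z : ℝ → E} {a b c d t₁ : ℝ} (hyz : y t₁ = z t₁)
    (hy : ∀ t ∈ Set.Ioo a b, HasDerivAt y (v t (y t)) t)
    (hz : ∀ t ∈ Set.Ioo c d, HasDerivAt z (v t (z t)) t)
    (hb : t₁ < b) (hc : c < t₁) (t : ℝ) (ht : t ∈ Set.Ioo a d) :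
    HasDerivAt (fun r => if r ≤ t₁ then y r else z r)
      (v t (if t ≤ t₁ then y t else z t)) t := by
  rcases lt_trichotomy t t₁ with h | h | h
  · rw [if_pos h.le]
    refine (hy t ⟨ht.1, h.trans hb⟩).congr_of_eventuallyEq ?_
    filter_upwards [Iio_mem_nhds h] with r hr
    exact if_pos (le_of_lt hr)
  · subst h
    rw [if_pos le_rfl]
    refine hasDerivAt_ite_le hyz (hy t ⟨ht.1, hb⟩) ?_
    rw [hyz]
    exact hz t ⟨hc, ht.2⟩
  · rw [if_neg (not_le.2 h)]
    refine (hz t ⟨hc.trans h, ht.2⟩).congr_of_eventuallyEq ?_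
    filter_upwards [Ioi_mem_nhds h] with r hr
    exact if_neg (not_le.2 hr)

variable [CompleteSpace E] {v : ℝ → E → E} {K : NNReal}

/-- A field with Lipschitz constant `K` has solutions for a time that depends on `K` only: on the
ball whose radius is the maximum `c` of `‖v t x₀‖`, the field is bounded by `(1 + K) c`. -/
theorem exists_local_solution (hK : ∀ t, LipschitzWith K (v t)) (hv : ∀ x, Continuous (v · x))
    (t₀ : ℝ) (x₀ : E) :
    ∃ y : ℝ → E, y t₀ = x₀ ∧
      ∀ t ∈ Set.Ioo (t₀ - 1 / (1 + K : ℝ)) (t₀ + 1 / (1 + K : ℝ)), HasDerivAt y (v t (y t)) t := by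
  set ε : ℝ := 1 / (1 + K : ℝ) with hε
  have hK0 : (0 : ℝ) < 1 + K := by positivity
  have hεpos : 0 < ε := by positivity
  obtain ⟨c, hc⟩ := (isCompact_Icc (a := t₀ - ε) (b := t₀ + ε)).exists_bound_of_continuousOn
    (hv x₀).continuousOn
  have hc0 : 0 ≤ c := (norm_nonneg _).trans (hc t₀ ⟨by linarith, by linarith⟩)
  lift c to NNReal using hc0
  have hPL : IsPicardLindelof v (tmin := t₀ - ε) (tmax := t₀ + ε)
      ⟨t₀, ⟨by linarith, by linarith⟩⟩ x₀ c 0 ((1 + K) * c) K := by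
    refine ⟨fun t _ => (hK t).lipschitzOnWith, fun x _ => (hv x).continuousOn, ?_, ?_⟩
    · intro t ht x hx
      have h1 := (hK t).dist_le_mul x x₀
      rw [dist_eq_norm] at h1
      have h2 := hc t ht
      have h3 : dist x x₀ ≤ c := hx
      have h4 : ‖v t x‖ ≤ ‖v t x - v t x₀‖ + ‖v t x₀‖ := by
        simpa using norm_add_le (v t x - v t x₀) (v t x₀)
      have h5 : (K : ℝ) * dist x x₀ ≤ K * c := by gcongr
      push_cast
      linarith
    · simp only [add_sub_cancel_left, sub_sub_cancel, max_self, NNReal.coe_zero, sub_zero]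
      push_cast
      rw [hε]
      apply le_of_eq
      field_simp
  obtain ⟨y, hy0, hy⟩ := hPL.exists_eq_forall_mem_Icc_hasDerivWithinAt₀
  exact ⟨y, hy0, fun t ht =>
    (hy t (Set.Ioo_subset_Icc_self ht)).hasDerivAt (Icc_mem_nhds ht.1 ht.2)⟩

/-- Repeated continuation at both ends, by half of the local existence time in each step. -/
theorem exists_solution_Ioo (hK : ∀ t, LipschitzWith K (v t)) (hv : ∀ x, Continuous (v · x))
    (t₀ : ℝ) (x₀ : E) (n : ℕ) :
    ∃ y : ℝ → E, y t₀ = x₀ ∧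
      ∀ t ∈ Set.Ioo (t₀ - (n + 1) * (1 / (2 * (1 + K : ℝ))))
        (t₀ + (n + 1) * (1 / (2 * (1 + K : ℝ)))), HasDerivAt y (v t (y t)) t := by
  set δ : ℝ := 1 / (2 * (1 + K : ℝ)) with hδ
  have hδpos : 0 < δ := by positivity
  have h2δ : 1 / (1 + K : ℝ) = 2 * δ := by rw [hδ]; field_simp
  induction n with
  | zero =>
    obtain ⟨y, hy0, hy⟩ := exists_local_solution hK hv t₀ x₀
    rw [h2δ] at hy
    refine ⟨y, hy0, fun t ht => hy t ⟨?_, ?_⟩⟩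
    · have := ht.1; push_cast at this; linarith
    · have := ht.2; push_cast at this; linarith
  | succ n ih =>
    obtain ⟨y, hy0, hy⟩ := ih
    have hn : (0 : ℝ) ≤ n * δ := by positivity
    -- the continuations start at distance `δ / 2` from the ends and exist for the time `2 δ`
    set t₁ := t₀ + (n + 1) * δ - δ / 2 with ht₁
    set t₂ := t₀ - (n + 1) * δ + δ / 2 with ht₂
    obtain ⟨z, hz0, hz⟩ := exists_local_solution hK hv t₁ (y t₁)
    obtain ⟨w, hw0, hw⟩ := exists_local_solution hK hv t₂ (y t₂)
    rw [h2δ] at hz hw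
    have h₁ : t₀ ≤ t₁ := by rw [ht₁]; nlinarith
    have h₂ : t₂ < t₀ := by rw [ht₂]; nlinarith
    have hy1 := hasDerivAt_glue (v := v) hz0.symm hy hz (by linarith) (by linarith)
    set y₁ : ℝ → E := fun r => if r ≤ t₁ then y r else z r with hy₁
    have hy₁t : y₁ t₂ = y t₂ := if_pos (by linarith)
    have hy2 := hasDerivAt_glue (v := v) (y := w) (z := y₁) (t₁ := t₂) (by rw [hw0, hy₁t]) hw
      hy1 (by linarith) (by linarith)
    refine ⟨fun r => if r ≤ t₂ then w r else y₁ r, ?_, fun t ht => hy2 t ⟨?_, ?_⟩⟩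
    · simp only [if_neg (not_le.2 h₂), hy₁, if_pos h₁, hy0]
    · have := ht.1; push_cast at this; nlinarith
    · have := ht.2; push_cast at this; nlinarith

/-- Global existence for the initial value problem of a uniformly Lipschitz vector field. -/
theorem exists_global_solution (hK : ∀ t, LipschitzWith K (v t)) (hv : ∀ x, Continuous (v · x))
    (t₀ : ℝ) (x₀ : E) :
    ∃ y : ℝ → E, y t₀ = x₀ ∧ ∀ t, HasDerivAt y (v t (y t)) t := by
  choose y hy0 hy using exists_solution_Ioo hK hv t₀ x₀
  set δ : ℝ := 1 / (2 * (1 + K : ℝ)) with hδ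
  have hδpos : 0 < δ := by positivity
  have key : ∀ n m : ℕ, n ≤ m → ∀ t ∈ Set.Ioo (t₀ - (n + 1) * δ) (t₀ + (n + 1) * δ),
      y n t = y m t := by
    intro n m hnm
    have hnm' : (n + 1) * δ ≤ (m + 1) * δ := by gcongr
    have hn : 0 < (n + 1) * δ := by positivity
    refine ODE_solution_unique_of_mem_Ioo (v := v) (s := fun _ => Set.univ) (t₀ := t₀)
      (fun t _ => (hK t).lipschitzOnWith) ⟨by linarith, by linarith⟩
      (fun t ht => ⟨hy n t ht, trivial⟩) (fun t ht => ⟨hy m t ⟨?_, ?_⟩, trivial⟩) ?_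
    · linarith [ht.1]
    · linarith [ht.2]
    · rw [hy0, hy0]
  have hmem : ∀ t : ℝ, ∀ n : ℕ, ⌊|t - t₀| / δ⌋₊ ≤ n →
      t ∈ Set.Ioo (t₀ - (n + 1) * δ) (t₀ + (n + 1) * δ) := by
    intro t n hn
    have h1 : |t - t₀| / δ < n + 1 :=
      (Nat.lt_floor_add_one _).trans_le (by gcongr)
    rw [div_lt_iff₀ hδpos, abs_lt] at h1
    exact ⟨by linarith [h1.1], by linarith [h1.2]⟩
  refine ⟨fun t => y ⌊|t - t₀| / δ⌋₊ t, hy0 _, fun t => ?_⟩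
  set n := ⌊|t - t₀| / δ⌋₊ with hn
  have hnt := hmem t n le_rfl
  refine (hy n t hnt).congr_of_eventuallyEq ?_
  filter_upwards [Ioo_mem_nhds hnt.1 hnt.2] with r hr
  rcases le_total ⌊|r - t₀| / δ⌋₊ n with h | h
  · exact key _ _ h r (hmem r _ le_rfl)
  · exact (key _ _ h r hr).symm

end GlobalExistence

/-! ### Decay of square integrable functions with square integrable derivative -/

section SquareIntegrable

variable {F : Type*} [NormedAddCommGroup F] [InnerProductSpace ℝ F] {f f' : ℝ → F}

/-- Both `‖f‖²` and its derivative `2 ⟪f, f'⟫` are integrable. -/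
theorem tendsto_atTop_zero_of_integrableOn_norm_sq (hf : ∀ x, HasDerivAt f (f' x) x)
    (hf' : Continuous f') {a : ℝ} (hi : IntegrableOn (fun x => ‖f x‖ ^ 2) (Set.Ioi a))
    (hi' : IntegrableOn (fun x => ‖f' x‖ ^ 2) (Set.Ioi a)) : Tendsto f atTop (𝓝 0) := by
  have hc : Continuous f := continuous_iff_continuousAt.2 fun x => (hf x).continuousAt
  have h1 : Tendsto (fun x => ‖f x‖ ^ 2) atTop (𝓝 0) := by
    refine tendsto_zero_of_hasDerivAt_of_integrableOn_Ioi (a := a)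
      (fun x _ => (hf x).norm_sq) ?_ hi
    refine Integrable.mono' (hi.add hi') ?_ (Eventually.of_forall fun x => ?_)
    · exact (continuous_const.mul (hc.inner hf')).aestronglyMeasurable
    · have h2 := abs_real_inner_le_norm (f x) (f' x)
      rw [Real.norm_eq_abs, abs_mul, abs_two]
      simp only [Pi.add_apply]
      nlinarith [sq_nonneg (‖f x‖ - ‖f' x‖)]
  have h3 := h1.sqrt
  simp only [Real.sqrt_zero, Real.sqrt_sq (norm_nonneg _)] at h3
  exact tendsto_zero_iff_norm_tendsto_zero.2 h3

theorem tendsto_atTop_zero_of_integrable_norm_sq (hf : ∀ x, HasDerivAt f (f' x) x)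
    (hf' : Continuous f') (hi : Integrable (fun x => ‖f x‖ ^ 2))
    (hi' : Integrable (fun x => ‖f' x‖ ^ 2)) : Tendsto f atTop (𝓝 0) :=
  tendsto_atTop_zero_of_integrableOn_norm_sq hf hf' (a := 0) hi.integrableOn hi'.integrableOn

theorem tendsto_atBot_zero_of_integrable_norm_sq (hf : ∀ x, HasDerivAt f (f' x) x)
    (hf' : Continuous f') (hi : Integrable (fun x => ‖f x‖ ^ 2))
    (hi' : Integrable (fun x => ‖f' x‖ ^ 2)) : Tendsto f atBot (𝓝 0) := by
  have h := tendsto_atTop_zero_of_integrable_norm_sq (f := fun x => f (-x))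
    (f' := fun x => -f' (-x)) (fun x => ?_) (hf'.comp continuous_neg).neg hi.comp_neg
    (by simpa using hi'.comp_neg)
  · simpa [Function.comp_def] using h.comp tendsto_neg_atBot_atTop
  · simpa [Function.comp_def] using (hf (-x)).scomp x (hasDerivAt_neg x)

end SquareIntegrable

/-! ### Linear systems with a Lyapunov form -/

section LinearSystems

/-- The space of all solutions of `Y' = M(x) Y` on the line: a decay condition along the trivial
filter is empty. -/
def solutionSpace (M : ℝ → Matrix (Fin 4) (Fin 4) ℂ) : Submodule ℂ (ℝ → Fin 4 → ℂ) :=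
  decaySpace M ⊥

variable {M : ℝ → Matrix (Fin 4) (Fin 4) ℂ} {K c : ℝ} {q : (Fin 4 → ℂ) → ℝ}
  {Y Z : ℝ → Fin 4 → ℂ}

theorem mem_solutionSpace : Y ∈ solutionSpace M ↔ ∀ x, HasDerivAt Y ((M x).mulVec (Y x)) x :=
  ⟨fun h => h.1, fun h => ⟨h, tendsto_bot⟩⟩

theorem decaySpace_le_solutionSpace (l : Filter ℝ) : decaySpace M l ≤ solutionSpace M :=
  fun _ h => mem_solutionSpace.2 h.1

/-- The system `Y' = M(x) Y` has continuous coefficients with `‖M(x)‖ ≤ K` on the line. -/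
structure IsBoundedSystem (M : ℝ → Matrix (Fin 4) (Fin 4) ℂ) (K : ℝ) : Prop where
  continuous : Continuous M
  norm_mulVec_le : ∀ x u, ‖(M x).mulVec u‖ ≤ K * ‖u‖

namespace IsBoundedSystem

theorem lipschitzWith (hM : IsBoundedSystem M K) (x : ℝ) :
    LipschitzWith K.toNNReal (fun u => (M x).mulVec u) := by
  refine LipschitzWith.of_dist_le_mul fun u v => ?_
  rw [dist_eq_norm, dist_eq_norm, ← Matrix.mulVec_sub]
  exact (hM.norm_mulVec_le x _).trans (by gcongr; exact Real.le_coe_toNNReal K)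

theorem solution_unique (hM : IsBoundedSystem M K) (hY : Y ∈ solutionSpace M)
    (hZ : Z ∈ solutionSpace M) {x : ℝ} (h : Y x = Z x) : Y = Z :=
  ODE_solution_unique_univ (v := fun x u => (M x).mulVec u) (s := fun _ => Set.univ)
    (fun t => (hM.lipschitzWith t).lipschitzOnWith)
    (fun t => ⟨mem_solutionSpace.1 hY t, trivial⟩) (fun t => ⟨mem_solutionSpace.1 hZ t, trivial⟩) h

theorem exists_solution (hM : IsBoundedSystem M K) (x : ℝ) (u : Fin 4 → ℂ) :
    ∃ Y ∈ solutionSpace M, Y x = u := by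
  obtain ⟨Y, h0, hY⟩ := exists_global_solution (v := fun x u => (M x).mulVec u)
    hM.lipschitzWith (fun u => hM.continuous.matrix_mulVec continuous_const) x u
  exact ⟨Y, mem_solutionSpace.2 hY, h0⟩

/-- Solutions correspond to their values at the point `x`. -/
def evalEquiv (hM : IsBoundedSystem M K) (x : ℝ) : solutionSpace M ≃ₗ[ℂ] (Fin 4 → ℂ) :=
  LinearEquiv.ofBijective ((LinearMap.proj x).comp (solutionSpace M).subtype)
    ⟨fun Y Z h => Subtype.ext (hM.solution_unique Y.2 Z.2 h), fun u => by
      obtain ⟨Y, hY, h⟩ := hM.exists_solution x u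
      exact ⟨⟨Y, hY⟩, h⟩⟩

@[simp]
theorem evalEquiv_apply (hM : IsBoundedSystem M K) (x : ℝ) (Y : solutionSpace M) :
    hM.evalEquiv x Y = (Y : ℝ → Fin 4 → ℂ) x := rfl

theorem evalEquiv_symm_apply_self (hM : IsBoundedSystem M K) (x : ℝ) (u : Fin 4 → ℂ) :
    ((hM.evalEquiv x).symm u : ℝ → Fin 4 → ℂ) x = u :=
  (hM.evalEquiv x).apply_symm_apply u

end IsBoundedSystem

/-- A function `q`, in the applications an indefinite quadratic form, that grows along every
solution of `Y' = M(x) Y` at the rate `c ‖Y‖²` at least. -/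
structure IsLyapunovForm (M : ℝ → Matrix (Fin 4) (Fin 4) ℂ) (q : (Fin 4 → ℂ) → ℝ) (c : ℝ) :
    Prop where
  continuous : Continuous q
  map_zero : q 0 = 0
  pos : 0 < c
  exists_hasDerivAt : ∀ Y ∈ solutionSpace M, ∃ d : ℝ → ℝ, ∀ x,
    HasDerivAt (fun x => q (Y x)) (d x) x ∧ c * ‖Y x‖ ^ 2 ≤ d x

namespace IsLyapunovForm

theorem monotone (hq : IsLyapunovForm M q c) (hY : Y ∈ solutionSpace M) :
    Monotone fun x => q (Y x) := by
  obtain ⟨d, hd⟩ := hq.exists_hasDerivAt Y hY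
  refine monotone_of_deriv_nonneg (fun x => (hd x).1.differentiableAt) fun x => ?_
  rw [(hd x).1.deriv]
  exact (mul_nonneg hq.pos.le (sq_nonneg _)).trans (hd x).2

theorem tendsto_comp (hq : IsLyapunovForm M q c) {l : Filter ℝ} (hY : Y ∈ decaySpace M l) :
    Tendsto (fun x => q (Y x)) l (𝓝 0) := by
  have h := (hq.continuous.tendsto 0).comp hY.2
  rwa [hq.map_zero] at h

theorem nonpos_of_mem_atTop (hq : IsLyapunovForm M q c) (hY : Y ∈ decaySpace M atTop) (x : ℝ) :
    q (Y x) ≤ 0 :=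
  (hq.monotone (decaySpace_le_solutionSpace _ hY)).ge_of_tendsto (hq.tendsto_comp hY) x

theorem nonneg_of_mem_atBot (hq : IsLyapunovForm M q c) (hY : Y ∈ decaySpace M atBot) (x : ℝ) :
    0 ≤ q (Y x) :=
  (hq.monotone (decaySpace_le_solutionSpace _ hY)).le_of_tendsto (hq.tendsto_comp hY) x

/-- No nonzero solution decays at both ends: along it the form would be at the same time
nonnegative, nonpositive and strictly increasing. -/
theorem eq_zero_of_mem_of_mem (hq : IsLyapunovForm M q c) (hbot : Y ∈ decaySpace M atBot)
    (htop : Y ∈ decaySpace M atTop) : Y = 0 := by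
  obtain ⟨d, hd⟩ := hq.exists_hasDerivAt Y (decaySpace_le_solutionSpace _ hbot)
  have h0 : (fun x => q (Y x)) = fun _ => 0 := funext fun x =>
    le_antisymm (hq.nonpos_of_mem_atTop htop x) (hq.nonneg_of_mem_atBot hbot x)
  funext x
  have h1 := (hd x).1
  rw [h0] at h1
  have h2 := (hd x).2
  rw [h1.unique (hasDerivAt_const x (0 : ℝ))] at h2
  have h3 : ‖Y x‖ ^ 2 ≤ 0 := by
    by_contra h
    exact absurd h2 (not_le.2 (mul_pos hq.pos (not_le.1 h)))
  have h4 : ‖Y x‖ = 0 := by nlinarith [norm_nonneg (Y x)]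
  exact norm_eq_zero.1 h4

/-- A solution along which the form stays nonpositive is square integrable on `[0, ∞)`, since the
form bounds `c ∫ ‖Y‖²`, and so it decays. -/
theorem mem_decaySpace_atTop (hq : IsLyapunovForm M q c) (hM : IsBoundedSystem M K)
    (hY : Y ∈ solutionSpace M) (h : ∀ x, 0 ≤ x → q (Y x) ≤ 0) : Y ∈ decaySpace M atTop := by
  have hY' := mem_solutionSpace.1 hY
  refine ⟨hY', ?_⟩
  obtain ⟨d, hd⟩ := hq.exists_hasDerivAt Y hY
  have hYc : Continuous Y := continuous_iff_continuousAt.2 fun x => (hY' x).continuousAt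
  have hbdd : BddAbove (Set.range fun x => q (Y x)) := by
    refine ⟨0, ?_⟩
    rintro _ ⟨x, rfl⟩
    exact (hq.monotone hY (le_max_left x 0)).trans (h _ (le_max_right x 0))
  have hdi : IntegrableOn d (Set.Ioi 0) :=
    integrableOn_Ioi_deriv_of_nonneg' (fun x _ => (hd x).1)
      (fun x _ => (mul_nonneg hq.pos.le (sq_nonneg _)).trans (hd x).2)
      (tendsto_atTop_ciSup (hq.monotone hY) hbdd)
  have hYi : IntegrableOn (fun x => ‖Y x‖ ^ 2) (Set.Ioi 0) := by
    refine Integrable.mono' (hdi.const_mul c⁻¹) (hYc.norm.pow 2).aestronglyMeasurable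
      (Eventually.of_forall fun x => ?_)
    rw [Real.norm_of_nonneg (sq_nonneg _), ← div_eq_inv_mul, le_div_iff₀ hq.pos, mul_comm]
    exact (hd x).2
  rw [tendsto_pi_nhds]
  intro i
  have hc' : Continuous fun x => (M x).mulVec (Y x) := hM.continuous.matrix_mulVec hYc
  refine tendsto_atTop_zero_of_integrableOn_norm_sq (a := 0)
    (f' := fun x => (M x).mulVec (Y x) i) (fun x => hasDerivAt_pi.1 (hY' x) i)
    ((continuous_apply i).comp hc') ?_ ?_
  · refine Integrable.mono' hYi (((continuous_apply i).comp hYc).norm.pow 2).aestronglyMeasurable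
      (Eventually.of_forall fun x => ?_)
    rw [Real.norm_of_nonneg (sq_nonneg _)]
    gcongr
    exact norm_le_pi_norm (Y x) i
  · refine Integrable.mono' (hYi.const_mul (K ^ 2))
      (((continuous_apply i).comp hc').norm.pow 2).aestronglyMeasurable
      (Eventually.of_forall fun x => ?_)
    rw [Real.norm_of_nonneg (sq_nonneg _), ← mul_pow]
    gcongr
    exact (norm_le_pi_norm _ i).trans (hM.norm_mulVec_le x _)

variable {π : (Fin 4 → ℂ) →ₗ[ℂ] (Fin 2 → ℂ)} {N : Submodule ℂ (Fin 4 → ℂ)} {κ : ℝ}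

/-- Shooting from the point `T`: the solutions with values in `N` at `T` have nonpositive form at
`0`, so that `π` is injective on their initial values; by a dimension count it is onto. -/
theorem exists_nonpos_at (hq : IsLyapunovForm M q c) (hM : IsBoundedSystem M K)
    (hN : Module.finrank ℂ N = 2) (hqN : ∀ u ∈ N, q u ≤ 0)
    (hπ : ∀ u, q u ≤ 0 → ‖u‖ ≤ κ * ‖π u‖) {T : ℝ} (hT : 0 ≤ T) (f : Fin 2 → ℂ) :
    ∃ Y ∈ solutionSpace M, π (Y 0) = f ∧ q (Y T) ≤ 0 := by
  let L : N →ₗ[ℂ] (Fin 2 → ℂ) :=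
    π ∘ₗ (hM.evalEquiv 0).toLinearMap ∘ₗ (hM.evalEquiv T).symm.toLinearMap ∘ₗ N.subtype
  have hLi : Function.Injective L := by
    rw [← LinearMap.ker_eq_bot, LinearMap.ker_eq_bot']
    intro u hu
    set Y := (hM.evalEquiv T).symm (u : Fin 4 → ℂ) with hY
    have hYT : (Y : ℝ → Fin 4 → ℂ) T = u := hM.evalEquiv_symm_apply_self T u
    have h1 : q ((Y : ℝ → Fin 4 → ℂ) 0) ≤ 0 :=
      (hq.monotone Y.2 hT).trans (by simpa only [hYT] using hqN u u.2)
    have h2 := hπ _ h1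
    have h3 : π ((Y : ℝ → Fin 4 → ℂ) 0) = 0 := hu
    rw [h3, norm_zero, mul_zero] at h2
    have h4 : hM.evalEquiv 0 Y = 0 := norm_le_zero_iff.1 h2
    have h5 : Y = 0 := (LinearEquiv.map_eq_zero_iff _).1 h4
    rw [hY, LinearEquiv.map_eq_zero_iff] at h5
    exact Subtype.ext h5
  have hLs : Function.Surjective L :=
    (LinearMap.injective_iff_surjective_of_finrank_eq_finrank (by simp [hN])).1 hLi
  obtain ⟨u, hu⟩ := hLs f
  refine ⟨(hM.evalEquiv T).symm (u : Fin 4 → ℂ), Subtype.property _, hu, ?_⟩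
  rw [hM.evalEquiv_symm_apply_self]
  exact hqN u u.2

/-- Every value of `π` is taken at `0` by a solution that decays at `+∞`. The initial values of the
solutions shot from `x = n` are bounded; a limit point of them starts a solution along which the
form is nonpositive. -/
theorem exists_mem_decaySpace_atTop (hq : IsLyapunovForm M q c) (hM : IsBoundedSystem M K)
    (hN : Module.finrank ℂ N = 2) (hqN : ∀ u ∈ N, q u ≤ 0)
    (hπ : ∀ u, q u ≤ 0 → ‖u‖ ≤ κ * ‖π u‖) (f : Fin 2 → ℂ) :
    ∃ Y ∈ decaySpace M atTop, π (Y 0) = f := by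
  choose Y hY hYf hYn using fun n : ℕ => hq.exists_nonpos_at hM hN hqN hπ (Nat.cast_nonneg n) f
  have hb : ∀ n, Y n 0 ∈ Metric.closedBall (0 : Fin 4 → ℂ) (κ * ‖f‖) := by
    intro n
    rw [mem_closedBall_zero_iff, ← hYf n]
    exact hπ _ ((hq.monotone (hY n) (Nat.cast_nonneg n)).trans (hYn n))
  obtain ⟨u, -, φ, hφ, hu⟩ := (isCompact_closedBall _ _).tendsto_subseq hb
  refine ⟨(hM.evalEquiv 0).symm u, hq.mem_decaySpace_atTop hM (Subtype.property _) ?_, ?_⟩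
  · intro x hx
    have hcont : Continuous fun w : Fin 4 → ℂ => hM.evalEquiv x ((hM.evalEquiv 0).symm w) :=
      LinearMap.continuous_of_finiteDimensional
        ((hM.evalEquiv x).toLinearMap ∘ₗ (hM.evalEquiv 0).symm.toLinearMap)
    have hlim := ((hq.continuous.comp hcont).tendsto u).comp hu
    refine le_of_tendsto hlim ?_
    filter_upwards [eventually_ge_atTop ⌈x⌉₊] with n hn
    have h1 : (hM.evalEquiv 0).symm (Y (φ n) 0) = ⟨Y (φ n), hY (φ n)⟩ :=
      (LinearEquiv.symm_apply_eq _).2 rfl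
    have h2 : x ≤ (φ n : ℕ) :=
      (Nat.le_ceil x).trans (by exact_mod_cast hn.trans (hφ.id_le n))
    simp only [Function.comp_apply, h1, IsBoundedSystem.evalEquiv_apply]
    exact (hq.monotone (hY (φ n)) h2).trans (hYn (φ n))
  · rw [hM.evalEquiv_symm_apply_self]
    have h1 := ((LinearMap.continuous_of_finiteDimensional π).tendsto u).comp hu
    refine tendsto_nhds_unique h1 ?_
    simp only [Function.comp_def, hYf]
    exact tendsto_const_nhds

/-- The solutions decaying at `+∞` form a space of dimension two. -/
theorem finrank_decaySpace_atTop (hq : IsLyapunovForm M q c) (hM : IsBoundedSystem M K)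
    (hN : Module.finrank ℂ N = 2) (hqN : ∀ u ∈ N, q u ≤ 0)
    (hπ : ∀ u, q u ≤ 0 → ‖u‖ ≤ κ * ‖π u‖) : Module.finrank ℂ (decaySpace M atTop) = 2 := by
  let L : decaySpace M atTop →ₗ[ℂ] (Fin 2 → ℂ) :=
    π ∘ₗ (LinearMap.proj 0).comp (decaySpace M atTop).subtype
  have hLi : Function.Injective L := by
    rw [← LinearMap.ker_eq_bot, LinearMap.ker_eq_bot']
    intro Y hY
    have h2 := hπ _ (hq.nonpos_of_mem_atTop Y.2 0)
    have h3 : π ((Y : ℝ → Fin 4 → ℂ) 0) = 0 := hY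
    rw [h3, norm_zero, mul_zero] at h2
    exact Subtype.ext (hM.solution_unique (decaySpace_le_solutionSpace _ Y.2)
      (Submodule.zero_mem _) (x := 0) (norm_le_zero_iff.1 h2))
  have hLs : Function.Surjective L := fun f => by
    obtain ⟨Y, hY, hf⟩ := hq.exists_mem_decaySpace_atTop hM hN hqN hπ f
    exact ⟨⟨Y, hY⟩, hf⟩
  rw [(LinearEquiv.ofBijective L ⟨hLi, hLs⟩).finrank_eq, Module.finrank_fin_fun]

end IsLyapunovForm

/-! ### Reflection of the line -/

theorem mem_decaySpace_comp_neg {l l' : Filter ℝ} (hl : Tendsto (fun x : ℝ => -x) l' l)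
    (hY : Y ∈ decaySpace M l) :
    (fun x => Y (-x)) ∈ decaySpace (fun x => -M (-x)) l' := by
  refine ⟨fun x => ?_, hY.2.comp hl⟩
  simpa [Function.comp_def, Matrix.neg_mulVec] using (hY.1 (-x)).scomp x (hasDerivAt_neg x)

theorem mem_decaySpace_of_comp_neg {l l' : Filter ℝ} (hl : Tendsto (fun x : ℝ => -x) l l')
    (hY : Y ∈ decaySpace (fun x => -M (-x)) l') : (fun x => Y (-x)) ∈ decaySpace M l := by
  simpa using mem_decaySpace_comp_neg hl hY

theorem IsBoundedSystem.comp_neg (hM : IsBoundedSystem M K) :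
    IsBoundedSystem (fun x => -M (-x)) K :=
  ⟨(hM.continuous.comp continuous_neg).neg, fun x u => by
    rw [Matrix.neg_mulVec, norm_neg]
    exact hM.norm_mulVec_le (-x) u⟩

theorem IsLyapunovForm.comp_neg (hq : IsLyapunovForm M q c) :
    IsLyapunovForm (fun x => -M (-x)) (fun u => -q u) c := by
  refine ⟨hq.continuous.neg, by simp [hq.map_zero], hq.pos, fun Y hY => ?_⟩
  obtain ⟨d, hd⟩ := hq.exists_hasDerivAt _
    (mem_decaySpace_of_comp_neg (l := ⊥) tendsto_bot hY)
  refine ⟨fun x => d (-x), fun x => ⟨?_, ?_⟩⟩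
  · simpa [Function.comp_def, Pi.neg_def] using ((hd (-x)).1.scomp x (hasDerivAt_neg x)).neg
  · simpa using (hd (-x)).2

/-- The solutions decaying at `-∞` form a space of dimension two: the reflected system has the
Lyapunov form `-q`. -/
theorem IsLyapunovForm.finrank_decaySpace_atBot (hq : IsLyapunovForm M q c)
    (hM : IsBoundedSystem M K) {π : (Fin 4 → ℂ) →ₗ[ℂ] (Fin 2 → ℂ)}
    {N : Submodule ℂ (Fin 4 → ℂ)} {κ : ℝ} (hN : Module.finrank ℂ N = 2)
    (hqN : ∀ u ∈ N, 0 ≤ q u) (hπ : ∀ u, 0 ≤ q u → ‖u‖ ≤ κ * ‖π u‖) :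
    Module.finrank ℂ (decaySpace M atBot) = 2 := by
  rw [← hq.comp_neg.finrank_decaySpace_atTop hM.comp_neg hN
    (fun u hu => neg_nonpos.2 (hqN u hu)) (fun u hu => hπ u (neg_nonpos.1 hu))]
  refine LinearEquiv.finrank_eq
    { toFun := fun Y => ⟨_, mem_decaySpace_comp_neg tendsto_neg_atTop_atBot Y.2⟩
      invFun := fun Y => ⟨_, mem_decaySpace_of_comp_neg tendsto_neg_atBot_atTop Y.2⟩
      map_add' := fun _ _ => rfl
      map_smul' := fun _ _ => rfl
      left_inv := fun Y => Subtype.ext (funext fun x => by simp)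
      right_inv := fun Y => Subtype.ext (funext fun x => by simp) }

end LinearSystems

/-! ### Evans frames of a system with a Lyapunov form -/

theorem Submodule.exists_pair_of_finrank_eq_two {V : Type*} [AddCommGroup V] [Module ℂ V]
    {S : Submodule ℂ V} (hS : Module.finrank ℂ S = 2) :
    ∃ y z : V, LinearIndependent ℂ ![y, z] ∧ Submodule.span ℂ {y, z} = S := by
  have : Module.Finite ℂ S := Module.finite_of_finrank_pos (by omega)
  let b := Module.finBasisOfFinrankEq ℂ S hS
  have hb : S.subtype ∘ b = ![(b 0 : V), (b 1 : V)] := by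
    ext i; fin_cases i <;> rfl
  refine ⟨b 0, b 1, ?_, ?_⟩
  · rw [← hb]
    exact b.linearIndependent.map' _ (Submodule.ker_subtype S)
  · have h := congrArg (Submodule.map S.subtype) b.span_eq
    rw [Submodule.map_span, ← Set.range_comp, hb, Submodule.map_subtype_top] at h
    refine Eq.trans ?_ h
    rw [Set.pair_comm]
    simp

theorem exists_isEvansFrame {M : ℝ → Matrix (Fin 4) (Fin 4) ℂ}
    (hbot : Module.finrank ℂ (decaySpace M atBot) = 2)
    (htop : Module.finrank ℂ (decaySpace M atTop) = 2) : ∃ Y, IsEvansFrame M Y := by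
  obtain ⟨Y₀, Y₁, h₁, h₂⟩ := Submodule.exists_pair_of_finrank_eq_two hbot
  obtain ⟨Y₂, Y₃, h₃, h₄⟩ := Submodule.exists_pair_of_finrank_eq_two htop
  exact ⟨![Y₀, Y₁, Y₂, Y₃], h₁, h₂, h₃, h₄⟩

/-- A linear relation between the columns of the Evans determinant produces, by uniqueness, a
solution that decays at both ends. -/
theorem IsLyapunovForm.evansDet_ne_zero {M : ℝ → Matrix (Fin 4) (Fin 4) ℂ} {K c : ℝ}
    {q : (Fin 4 → ℂ) → ℝ} (hq : IsLyapunovForm M q c) (hM : IsBoundedSystem M K)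
    {Y : Fin 4 → ℝ → Fin 4 → ℂ} (h₀ : Y 0 ∈ decaySpace M atBot) (h₁ : Y 1 ∈ decaySpace M atBot)
    (h₂ : Y 2 ∈ decaySpace M atTop) (h₃ : Y 3 ∈ decaySpace M atTop)
    (hbot : LinearIndependent ℂ ![Y 0, Y 1]) (htop : LinearIndependent ℂ ![Y 2, Y 3]) :
    evansDet Y ≠ 0 := by
  intro h
  obtain ⟨w, hw, hw0⟩ := Matrix.exists_mulVec_eq_zero_iff.2 h
  have hZ₁ : w 0 • Y 0 + w 1 • Y 1 ∈ decaySpace M atBot :=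
    add_mem (Submodule.smul_mem _ _ h₀) (Submodule.smul_mem _ _ h₁)
  have hZ₂ : -(w 2 • Y 2 + w 3 • Y 3) ∈ decaySpace M atTop :=
    neg_mem (add_mem (Submodule.smul_mem _ _ h₂) (Submodule.smul_mem _ _ h₃))
  have heq : w 0 • Y 0 + w 1 • Y 1 = -(w 2 • Y 2 + w 3 • Y 3) := by
    refine hM.solution_unique (decaySpace_le_solutionSpace _ hZ₁)
      (decaySpace_le_solutionSpace _ hZ₂) (x := 0) (funext fun i => ?_)
    have := congrFun hw0 i
    simp only [Matrix.mulVec, dotProduct, Matrix.of_apply, Fin.sum_univ_four,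
      Pi.zero_apply] at this
    simp only [Pi.add_apply, Pi.smul_apply, Pi.neg_apply, smul_eq_mul]
    linear_combination this
  have hzero : w 0 • Y 0 + w 1 • Y 1 = 0 := hq.eq_zero_of_mem_of_mem hZ₁ (heq ▸ hZ₂)
  have hzero' : w 2 • Y 2 + w 3 • Y 3 = 0 := neg_eq_zero.1 (heq ▸ hzero)
  obtain ⟨e₀, e₁⟩ := LinearIndependent.pair_iff.1 hbot _ _ hzero
  obtain ⟨e₂, e₃⟩ := LinearIndependent.pair_iff.1 htop _ _ hzero'
  exact hw (funext fun i => by fin_cases i <;> assumption)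

theorem IsEvansFrame.mem_decaySpace {M : ℝ → Matrix (Fin 4) (Fin 4) ℂ}
    {Y : Fin 4 → ℝ → Fin 4 → ℂ} (hY : IsEvansFrame M Y) :
    (Y 0 ∈ decaySpace M atBot ∧ Y 1 ∈ decaySpace M atBot) ∧
      Y 2 ∈ decaySpace M atTop ∧ Y 3 ∈ decaySpace M atTop := by
  rw [← hY.span_bot, ← hY.span_top]
  exact ⟨⟨Submodule.subset_span (by simp), Submodule.subset_span (by simp)⟩,
    Submodule.subset_span (by simp), Submodule.subset_span (by simp)⟩

/-! ### Solutions with prescribed exponential asymptotics -/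

section Asymptotics

variable {l : Filter ℝ} {Y Z : ℝ → Fin 4 → ℂ} {ν ν' : ℂ} {v v' : Fin 4 → ℂ}

theorem tendsto_zero_of_exp_smul
    (h : Tendsto (fun x : ℝ => Complex.exp (-ν * x) • Y x) l (𝓝 v))
    (hν : Tendsto (fun x : ℝ => ν.re * x) l atBot) : Tendsto Y l (𝓝 0) := by
  have h1 : Tendsto (fun x : ℝ => Complex.exp (ν * x)) l (𝓝 0) := by
    rw [tendsto_zero_iff_norm_tendsto_zero]
    simpa [Complex.norm_exp, Function.comp_def] using Real.tendsto_exp_atBot.comp hν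
  have h2 := h1.smul h
  rw [zero_smul] at h2
  refine h2.congr fun x => ?_
  rw [smul_smul, ← Complex.exp_add]
  simp

/-- In a linear relation between two such solutions, the one that is not smaller has coefficient
zero: a functional that vanishes on the other limit vector detects it. -/
theorem coeff_eq_zero_of_exp_smul [l.NeBot]
    (hY : Tendsto (fun x : ℝ => Complex.exp (-ν * x) • Y x) l (𝓝 v))
    (hZ : Tendsto (fun x : ℝ => Complex.exp (-ν' * x) • Z x) l (𝓝 v'))
    (hv : LinearIndependent ℂ ![v, v'])
    (hle : ∀ᶠ x in l, (ν'.re - ν.re) * x ≤ 0) {a b : ℂ} (hab : a • Y + b • Z = 0) :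
    a = 0 := by
  have hmem : v ∉ Submodule.span ℂ {v'} := by
    intro h
    obtain ⟨t, ht⟩ := Submodule.mem_span_singleton.1 h
    have := (LinearIndependent.pair_iff.1 hv 1 (-t) (by rw [← ht]; simp)).1
    exact one_ne_zero this
  obtain ⟨φ, hφ, hker⟩ := Submodule.exists_le_ker_of_notMem hmem
  have hφ' : φ v' = 0 := hker (Submodule.mem_span_singleton_self v')
  have hφc := LinearMap.continuous_of_finiteDimensional φ
  have h1 := ((hφc.tendsto _).comp hY).const_mul a
  have h2 := ((hφc.tendsto _).comp hZ).const_mul b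
  rw [hφ', mul_zero] at h2
  -- the quotient of the two exponentials stays bounded
  have h3 : Tendsto (fun x : ℝ => -(b * (φ ∘ fun x : ℝ => Complex.exp (-ν' * x) • Z x) x) *
      Complex.exp ((ν' - ν) * x)) l (𝓝 0) := by
    refine Tendsto.zero_mul_isBoundedUnder_le (by simpa using h2.neg) ⟨1, ?_⟩
    rw [eventually_map]
    filter_upwards [hle] with x hx
    simpa [Complex.norm_exp] using hx
  have h4 : ∀ x : ℝ, -(b * (φ ∘ fun x : ℝ => Complex.exp (-ν' * x) • Z x) x) *
      Complex.exp ((ν' - ν) * x) = a * (φ ∘ fun x : ℝ => Complex.exp (-ν * x) • Y x) x := by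
    intro x
    have h5 : a * φ (Y x) + b * φ (Z x) = 0 := by
      have := congrArg φ (congrFun hab x)
      simpa using this
    have h6 : Complex.exp (-ν * x) = Complex.exp (-ν' * x) * Complex.exp ((ν' - ν) * x) := by
      rw [← Complex.exp_add]; congr 1; ring
    simp only [Function.comp_apply, map_smul, smul_eq_mul, h6]
    linear_combination (-Complex.exp (-ν' * x) * Complex.exp ((ν' - ν) * x)) * h5
  have h7 := tendsto_nhds_unique (h3.congr h4) h1
  exact (mul_eq_zero.1 h7.symm).resolve_right hφ

theorem linearIndependent_of_exp_smul [l.NeBot] (hl : (∀ᶠ x in l, 0 ≤ x) ∨ ∀ᶠ x in l, x ≤ 0)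
    (hY : Tendsto (fun x : ℝ => Complex.exp (-ν * x) • Y x) l (𝓝 v))
    (hZ : Tendsto (fun x : ℝ => Complex.exp (-ν' * x) • Z x) l (𝓝 v'))
    (hv : LinearIndependent ℂ ![v, v']) : LinearIndependent ℂ ![Y, Z] := by
  have hv' : LinearIndependent ℂ ![v', v] := LinearIndependent.pair_symm_iff.1 hv
  have hle : (∀ᶠ x in l, (ν'.re - ν.re) * x ≤ 0) ∨ ∀ᶠ x in l, (ν.re - ν'.re) * x ≤ 0 := by
    rcases hl with h | h <;> rcases le_total ν.re ν'.re with h' | h'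
    · right; filter_upwards [h] with x hx; nlinarith
    · left; filter_upwards [h] with x hx; nlinarith
    · left; filter_upwards [h] with x hx; nlinarith
    · right; filter_upwards [h] with x hx; nlinarith
  have hv0 : v ≠ 0 := hv.ne_zero 0
  have hv0' : v' ≠ 0 := hv'.ne_zero 0
  -- a solution with nonzero limit vector is not the zero function
  have hne : ∀ {Y : ℝ → Fin 4 → ℂ} {ν : ℂ} {v : Fin 4 → ℂ}, v ≠ 0 →
      Tendsto (fun x : ℝ => Complex.exp (-ν * x) • Y x) l (𝓝 v) → Y ≠ 0 := by
    rintro Y ν v hv h rfl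
    simp only [Pi.zero_apply, smul_zero] at h
    exact hv (tendsto_nhds_unique h tendsto_const_nhds)
  refine LinearIndependent.pair_iff.2 fun a b hab => ?_
  rcases hle with h | h
  · obtain rfl := coeff_eq_zero_of_exp_smul hY hZ hv h hab
    rw [zero_smul, zero_add] at hab
    exact ⟨rfl, (smul_eq_zero.1 hab).resolve_right (hne hv0' hZ)⟩
  · rw [add_comm] at hab
    obtain rfl := coeff_eq_zero_of_exp_smul hZ hY hv' h hab
    rw [zero_smul, zero_add] at hab
    exact ⟨(smul_eq_zero.1 hab).resolve_right (hne hv0 hY), rfl⟩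

end Asymptotics

/-! ### Lyapunov forms of perturbed diagonal systems -/

/-- The form `|w₂|² + |w₃|² - |w₀|² - |w₁|²` in the coordinates `w = L u`: the unstable minus the
stable part. -/
def modeForm (L : Matrix (Fin 4) (Fin 4) ℂ) (u : Fin 4 → ℂ) : ℝ :=
  ‖L.mulVec u 2‖ ^ 2 + ‖L.mulVec u 3‖ ^ 2 - (‖L.mulVec u 0‖ ^ 2 + ‖L.mulVec u 1‖ ^ 2)

/-- The two coordinates of `w = L u` with the indices `j` and `k`. -/
def modePair (L : Matrix (Fin 4) (Fin 4) ℂ) (j k : Fin 4) : (Fin 4 → ℂ) →ₗ[ℂ] (Fin 2 → ℂ) :=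
  LinearMap.funLeft ℂ ℂ ![j, k] ∘ₗ L.mulVecLin

theorem sum_sum_mul_mul_le (r : Fin 4 → Fin 4 → ℝ) (x : Fin 4 → ℝ) :
    ∑ j, ∑ i, r j i * (x j * x i) ≤ √(∑ j, ∑ i, r j i ^ 2) * ∑ j, x j ^ 2 := by
  have h := Real.sum_mul_le_sqrt_mul_sqrt (Finset.univ : Finset (Fin 4 × Fin 4))
    (fun p => r p.1 p.2) (fun p => x p.1 * x p.2)
  rw [Fintype.sum_prod_type, Fintype.sum_prod_type, Fintype.sum_prod_type] at h
  have h2 : ∑ j, ∑ i, (x j * x i) ^ 2 = (∑ j, x j ^ 2) ^ 2 := by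
    rw [sq, Finset.sum_mul_sum]
    simp only [mul_pow]
  rw [h2, Real.sqrt_sq (Finset.sum_nonneg fun _ _ => sq_nonneg _)] at h
  exact h

/-- The system matrix `A` becomes, in the coordinates `w = L u`, the diagonal matrix with entries
`d` plus the perturbation `R`. -/
def IsPerturbedDiagonal (L A : Matrix (Fin 4) (Fin 4) ℂ) (d : Fin 4 → ℂ)
    (R : Fin 4 → Fin 4 → ℂ) : Prop :=
  ∀ u j, L.mulVec (A.mulVec u) j = d j * L.mulVec u j + ∑ i, R j i * L.mulVec u i

theorem IsPerturbedDiagonal.growth {L A : Matrix (Fin 4) (Fin 4) ℂ} {d : Fin 4 → ℂ}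
    {R : Fin 4 → Fin 4 → ℂ} (h : IsPerturbedDiagonal L A d R) {β δ : ℝ}
    (h0 : (d 0).re ≤ -β) (h1 : (d 1).re ≤ -β) (h2 : β ≤ (d 2).re) (h3 : β ≤ (d 3).re)
    (hR : √(∑ j, ∑ i, ‖R j i‖ ^ 2) ≤ δ) (u : Fin 4 → ℂ) :
    2 * (β - δ) * ∑ j, ‖L.mulVec u j‖ ^ 2 ≤
      2 * inner ℝ (L.mulVec u 2) (L.mulVec (A.mulVec u) 2)
        + 2 * inner ℝ (L.mulVec u 3) (L.mulVec (A.mulVec u) 3)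
        - (2 * inner ℝ (L.mulVec u 0) (L.mulVec (A.mulVec u) 0)
          + 2 * inner ℝ (L.mulVec u 1) (L.mulVec (A.mulVec u) 1)) := by
  set w := L.mulVec u with hw
  set T : Fin 4 → ℂ := fun j => ∑ i, R j i * w i with hT
  have hin : ∀ j, inner ℝ (w j) (L.mulVec (A.mulVec u) j)
      = (d j).re * ‖w j‖ ^ 2 + inner ℝ (w j) (T j) := by
    intro j
    rw [h u j, inner_add_right]
    congr 1
    rw [Complex.inner, mul_assoc, Complex.mul_conj, Complex.re_mul_ofReal,
      Complex.normSq_eq_norm_sq]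
  have hTj : ∀ j, |inner ℝ (w j) (T j)| ≤ ∑ i, ‖R j i‖ * (‖w j‖ * ‖w i‖) := by
    intro j
    refine (abs_real_inner_le_norm _ _).trans ?_
    calc ‖w j‖ * ‖T j‖ ≤ ‖w j‖ * ∑ i, ‖R j i * w i‖ := by
          gcongr; exact norm_sum_le _ _
      _ = _ := by
          rw [Finset.mul_sum]
          refine Finset.sum_congr rfl fun i _ => ?_
          rw [norm_mul]; ring
  have hS := (Finset.sum_le_sum fun j (_ : j ∈ Finset.univ) => hTj j).trans
    (sum_sum_mul_mul_le (fun j i => ‖R j i‖) (fun j => ‖w j‖))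
  have hS2 : ∑ j, |inner ℝ (w j) (T j)| ≤ δ * ∑ j, ‖w j‖ ^ 2 :=
    hS.trans (by gcongr)
  simp only [hin]
  simp only [Fin.sum_univ_four] at hS2 ⊢
  have e0 := neg_abs_le (inner ℝ (w 2) (T 2))
  have e1 := neg_abs_le (inner ℝ (w 3) (T 3))
  have e2 := le_abs_self (inner ℝ (w 0) (T 0))
  have e3 := le_abs_self (inner ℝ (w 1) (T 1))
  have g0 := mul_le_mul_of_nonneg_right h0 (sq_nonneg ‖w 0‖)
  have g1 := mul_le_mul_of_nonneg_right h1 (sq_nonneg ‖w 1‖)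
  have g2 := mul_le_mul_of_nonneg_right h2 (sq_nonneg ‖w 2‖)
  have g3 := mul_le_mul_of_nonneg_right h3 (sq_nonneg ‖w 3‖)
  linarith

section Coordinates

variable {L V : Matrix (Fin 4) (Fin 4) ℂ} {M : ℝ → Matrix (Fin 4) (Fin 4) ℂ}

theorem exists_norm_sq_le_of_mul_eq_one (hVL : V * L = 1) :
    ∃ κ : ℝ, 0 < κ ∧ ∀ u, ‖u‖ ^ 2 ≤ κ * ∑ j, ‖L.mulVec u j‖ ^ 2 := by
  obtain ⟨κ, hκ, h⟩ := (LinearMap.toContinuousLinearMap V.mulVecLin).bound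
  refine ⟨κ ^ 2, by positivity, fun u => ?_⟩
  have h1 : ‖u‖ ≤ κ * ‖L.mulVec u‖ := by
    simpa [hVL] using h (L.mulVec u)
  have h2 : ‖L.mulVec u‖ ^ 2 ≤ ∑ j, ‖L.mulVec u j‖ ^ 2 := by
    obtain ⟨j, hj⟩ := Finite.exists_max fun j => ‖L.mulVec u j‖
    have h3 : ‖L.mulVec u‖ ≤ ‖L.mulVec u j‖ :=
      (pi_norm_le_iff_of_nonneg (norm_nonneg _)).2 hj
    calc ‖L.mulVec u‖ ^ 2 ≤ ‖L.mulVec u j‖ ^ 2 := by gcongr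
      _ ≤ _ := Finset.single_le_sum (f := fun j => ‖L.mulVec u j‖ ^ 2)
          (fun _ _ => sq_nonneg _) (Finset.mem_univ j)
  calc ‖u‖ ^ 2 ≤ (κ * ‖L.mulVec u‖) ^ 2 := by gcongr
    _ = κ ^ 2 * ‖L.mulVec u‖ ^ 2 := by ring
    _ ≤ _ := by gcongr

/-- If the spectral gap `β` exceeds the Frobenius norm of the perturbation, then `modeForm` grows
along all solutions. -/
theorem exists_isLyapunovForm_modeForm (hVL : V * L = 1) {d : Fin 4 → ℂ}
    {R : ℝ → Fin 4 → Fin 4 → ℂ} (h : ∀ x, IsPerturbedDiagonal L (M x) d (R x)) {β δ : ℝ}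
    (h0 : (d 0).re ≤ -β) (h1 : (d 1).re ≤ -β) (h2 : β ≤ (d 2).re) (h3 : β ≤ (d 3).re)
    (hR : ∀ x, √(∑ j, ∑ i, ‖R x j i‖ ^ 2) ≤ δ) (hδ : δ < β) :
    ∃ c, IsLyapunovForm M (modeForm L) c := by
  obtain ⟨κ, hκ, hκu⟩ := exists_norm_sq_le_of_mul_eq_one hVL
  refine ⟨2 * (β - δ) / κ, ⟨?_, by simp [modeForm], by have := sub_pos.2 hδ; positivity,
    fun Y hY => ?_⟩⟩
  · have hc : ∀ j, Continuous fun u => L.mulVec u j := fun j =>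
      (continuous_apply j).comp (continuous_const.matrix_mulVec continuous_id)
    have h2 : ∀ j, Continuous fun u => ‖L.mulVec u j‖ ^ 2 := fun j => (hc j).norm.pow 2
    exact ((h2 2).add (h2 3)).sub ((h2 0).add (h2 1))
  · have hd : ∀ j x, HasDerivAt (fun x => ‖L.mulVec (Y x) j‖ ^ 2)
        (2 * inner ℝ (L.mulVec (Y x) j) (L.mulVec ((M x).mulVec (Y x)) j)) x := by
      intro j x
      refine HasDerivAt.norm_sq ?_
      have hYi := hasDerivAt_pi.1 (mem_solutionSpace.1 hY x)
      exact HasDerivAt.fun_sum (u := Finset.univ) fun i _ => (hYi i).const_mul (L j i)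
    refine ⟨_, fun x => ⟨((hd 2 x).add (hd 3 x)).sub ((hd 0 x).add (hd 1 x)), ?_⟩⟩
    refine le_trans ?_ ((h x).growth h0 h1 h2 h3 (hR x) (Y x))
    rw [div_mul_eq_mul_div, div_le_iff₀ hκ, mul_assoc, mul_assoc (2 * (β - δ))]
    have := hκu (Y x)
    have := sub_pos.2 hδ
    rw [mul_comm _ κ, mul_assoc 2 (β - δ)]
    gcongr

theorem modePair_surjective (hVL : V * L = 1) {j k : Fin 4} (hjk : j ≠ k) :
    Function.Surjective (modePair L j k) := by
  rw [modePair, LinearMap.coe_comp]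
  refine (LinearMap.funLeft_surjective_of_injective _ _ _ ?_).comp fun w => ⟨V.mulVec w, ?_⟩
  · intro a b hab
    fin_cases a <;> fin_cases b <;> simp_all [eq_comm]
  · simp [mul_eq_one_comm.1 hVL]

theorem finrank_ker_modePair (hVL : V * L = 1) {j k : Fin 4} (hjk : j ≠ k) :
    Module.finrank ℂ (LinearMap.ker (modePair L j k)) = 2 := by
  have h := (modePair L j k).finrank_range_add_finrank_ker
  rw [LinearMap.range_eq_top.2 (modePair_surjective hVL hjk), finrank_top,
    Module.finrank_fin_fun, Module.finrank_fin_fun] at h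
  omega

theorem mem_ker_modePair {j k : Fin 4} {u : Fin 4 → ℂ} :
    u ∈ LinearMap.ker (modePair L j k) ↔ L.mulVec u j = 0 ∧ L.mulVec u k = 0 := by
  rw [LinearMap.mem_ker, funext_iff, Fin.forall_fin_two]
  rfl

theorem norm_sq_le_modePair (j k : Fin 4) (u : Fin 4 → ℂ) :
    ‖L.mulVec u j‖ ^ 2 + ‖L.mulVec u k‖ ^ 2 ≤ 2 * ‖modePair L j k u‖ ^ 2 := by
  have h0 : ‖L.mulVec u j‖ ≤ ‖modePair L j k u‖ := norm_le_pi_norm (modePair L j k u) 0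
  have h1 : ‖L.mulVec u k‖ ≤ ‖modePair L j k u‖ := norm_le_pi_norm (modePair L j k u) 1
  have := pow_le_pow_left₀ (norm_nonneg _) h0 2
  have := pow_le_pow_left₀ (norm_nonneg _) h1 2
  linarith

theorem exists_norm_le_modePair_of_nonpos (hVL : V * L = 1) :
    ∃ κ : ℝ, ∀ u, modeForm L u ≤ 0 → ‖u‖ ≤ κ * ‖modePair L 0 1 u‖ := by
  obtain ⟨κ, hκ, hκu⟩ := exists_norm_sq_le_of_mul_eq_one hVL
  refine ⟨√(4 * κ), fun u hu => ?_⟩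
  rw [modeForm] at hu
  refine le_of_sq_le_sq ?_ (by positivity)
  rw [mul_pow, Real.sq_sqrt (by positivity)]
  refine (hκu u).trans ?_
  rw [Fin.sum_univ_four, mul_comm 4 κ, mul_assoc]
  have := norm_sq_le_modePair (L := L) 0 1 u
  gcongr
  linarith

theorem exists_norm_le_modePair_of_nonneg (hVL : V * L = 1) :
    ∃ κ : ℝ, ∀ u, 0 ≤ modeForm L u → ‖u‖ ≤ κ * ‖modePair L 2 3 u‖ := by
  obtain ⟨κ, hκ, hκu⟩ := exists_norm_sq_le_of_mul_eq_one hVL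
  refine ⟨√(4 * κ), fun u hu => ?_⟩
  rw [modeForm] at hu
  refine le_of_sq_le_sq ?_ (by positivity)
  rw [mul_pow, Real.sq_sqrt (by positivity)]
  refine (hκu u).trans ?_
  rw [Fin.sum_univ_four, mul_comm 4 κ, mul_assoc]
  have := norm_sq_le_modePair (L := L) 2 3 u
  gcongr
  linarith

theorem finrank_decaySpace_of_modeForm (hVL : V * L = 1) {K c : ℝ} (hM : IsBoundedSystem M K)
    (hq : IsLyapunovForm M (modeForm L) c) :
    Module.finrank ℂ (decaySpace M atBot) = 2 ∧ Module.finrank ℂ (decaySpace M atTop) = 2 := by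
  obtain ⟨κ, hκ⟩ := exists_norm_le_modePair_of_nonpos hVL
  obtain ⟨κ', hκ'⟩ := exists_norm_le_modePair_of_nonneg hVL
  refine ⟨hq.finrank_decaySpace_atBot hM (finrank_ker_modePair hVL (j := 0) (k := 1) (by decide))
    (fun u hu => ?_) hκ',
    hq.finrank_decaySpace_atTop hM (finrank_ker_modePair hVL (j := 2) (k := 3) (by decide))
    (fun u hu => ?_) hκ⟩
  · obtain ⟨e0, e1⟩ := mem_ker_modePair.1 hu
    rw [modeForm, e0, e1]
    simp only [norm_zero]
    nlinarith [sq_nonneg ‖L.mulVec u 2‖, sq_nonneg ‖L.mulVec u 3‖]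
  · obtain ⟨e0, e1⟩ := mem_ker_modePair.1 hu
    rw [modeForm, e0, e1]
    simp only [norm_zero]
    nlinarith [sq_nonneg ‖L.mulVec u 0‖, sq_nonneg ‖L.mulVec u 1‖]

end Coordinates

/-! ### Diagonalization of the biquadratic companion matrix -/

/-- The roots of `z⁴ - (ζ² + η²) z² + ζ² η²`. -/
def biquadRoot (ζ η : ℂ) : Fin 4 → ℂ := ![-ζ, -η, ζ, η]

/-- The values at the roots of the derivative of `z⁴ - (ζ² + η²) z² + ζ² η²`. -/
def biquadDeriv (ζ η : ℂ) : Fin 4 → ℂ :=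
  ![-(2 * ζ * (ζ ^ 2 - η ^ 2)), -(2 * η * (η ^ 2 - ζ ^ 2)),
    2 * ζ * (ζ ^ 2 - η ^ 2), 2 * η * (η ^ 2 - ζ ^ 2)]

/-- The mode coordinates: row `j` is the left eigenvector of the companion matrix for the root
`z_j`, that is the coefficients of `∏_{l ≠ j} (z - z_l)`, divided by `∏_{l ≠ j} (z_j - z_l)`. -/
def modeMatrix (ζ η : ℂ) : Matrix (Fin 4) (Fin 4) ℂ :=
  !![ζ * η ^ 2 / biquadDeriv ζ η 0, -η ^ 2 / biquadDeriv ζ η 0, -ζ / biquadDeriv ζ η 0,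
      1 / biquadDeriv ζ η 0;
    η * ζ ^ 2 / biquadDeriv ζ η 1, -ζ ^ 2 / biquadDeriv ζ η 1, -η / biquadDeriv ζ η 1,
      1 / biquadDeriv ζ η 1;
    -ζ * η ^ 2 / biquadDeriv ζ η 2, -η ^ 2 / biquadDeriv ζ η 2, ζ / biquadDeriv ζ η 2,
      1 / biquadDeriv ζ η 2;
    -η * ζ ^ 2 / biquadDeriv ζ η 3, -ζ ^ 2 / biquadDeriv ζ η 3, η / biquadDeriv ζ η 3,
      1 / biquadDeriv ζ η 3]

section Biquadratic

variable {ζ η : ℂ}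

/-- The mode coordinates invert the Vandermonde matrix. -/
theorem vandermonde_mul_modeMatrix (hζ : ζ ≠ 0) (hη : η ≠ 0) (h : ζ ^ 2 - η ^ 2 ≠ 0) :
    (Matrix.vandermonde (biquadRoot ζ η)).transpose * modeMatrix ζ η = 1 := by
  have h' : η ^ 2 - ζ ^ 2 ≠ 0 := fun h0 => h (by linear_combination -h0)
  ext i j
  fin_cases i <;> fin_cases j <;>
    simp [Matrix.mul_apply, Fin.sum_univ_four, Matrix.vandermonde, biquadRoot, modeMatrix,
      biquadDeriv] <;> field_simp <;> ring

theorem isPerturbedDiagonal_companion4 (hζ : ζ ≠ 0) (hη : η ≠ 0) (h : ζ ^ 2 - η ^ 2 ≠ 0)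
    (r : Fin 4 → ℂ) :
    IsPerturbedDiagonal (modeMatrix ζ η)
      (companion4 (ζ ^ 2 * η ^ 2 + r 0) (r 1) (-(ζ ^ 2 + η ^ 2) + r 2) (r 3))
      (biquadRoot ζ η)
      (fun j i => -(∑ l, r l * biquadRoot ζ η i ^ (l : ℕ)) / biquadDeriv ζ η j) := by
  intro u j
  have hu : ∀ l : Fin 4, ∑ i, biquadRoot ζ η i ^ (l : ℕ) * (modeMatrix ζ η).mulVec u i = u l := by
    intro l
    have h1 := congrFun (congrArg (Matrix.mulVec · u) (vandermonde_mul_modeMatrix hζ hη h)) l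
    simp only [← Matrix.mulVec_mulVec, Matrix.one_mulVec] at h1
    exact h1
  have hsum : ∑ i, -(∑ l, r l * biquadRoot ζ η i ^ (l : ℕ)) / biquadDeriv ζ η j *
      (modeMatrix ζ η).mulVec u i = -(∑ l, r l * u l) / biquadDeriv ζ η j := by
    rw [← Finset.sum_congr rfl fun l _ => congrArg (r l * ·) (hu l)]
    simp only [Fin.sum_univ_four]
    ring
  rw [hsum]
  have h' : η ^ 2 - ζ ^ 2 ≠ 0 := fun h0 => h (by linear_combination -h0)
  fin_cases j <;>
    simp [Matrix.mulVec, dotProduct, Fin.sum_univ_four, biquadRoot, modeMatrix, biquadDeriv,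
      companion4] <;> field_simp <;> ring

end Biquadratic

/-! ### The roots `z_j` and the constants `α`, `g_j` -/

section Roots

variable {μ : ℝ}

theorem norm_half_add_I_mul_sqrt (hμ : 0 < μ) (hμ2 : μ < 2) :
    ‖(μ / 2 + Complex.I * (√(1 - μ ^ 2 / 4) : ℝ) : ℂ)‖ = 1 := by
  have h : (0 : ℝ) ≤ 1 - μ ^ 2 / 4 := by nlinarith
  have e : (μ / 2 + Complex.I * (√(1 - μ ^ 2 / 4) : ℝ) : ℂ)
      = ((μ / 2 : ℝ) : ℂ) + ((√(1 - μ ^ 2 / 4) : ℝ) : ℂ) * Complex.I := by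
    push_cast; ring
  rw [e, Complex.norm_add_mul_I, Real.sq_sqrt h, Real.sqrt_eq_one]
  ring

theorem exp_I_mul_theta₁ (hμ : 0 < μ) (hμ2 : μ < 2) :
    Complex.exp (Complex.I * theta₁ μ) = μ / 2 + Complex.I * (√(1 - μ ^ 2 / 4) : ℝ) := by
  have h := Complex.norm_mul_exp_arg_mul_I (μ / 2 + Complex.I * (√(1 - μ ^ 2 / 4) : ℝ))
  rw [norm_half_add_I_mul_sqrt hμ hμ2, Complex.ofReal_one, one_mul] at h
  rw [← h, mul_comm]
  rfl

theorem abs_theta₁_le (hμ : 0 < μ) : |theta₁ μ| ≤ Real.pi / 2 := by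
  rw [theta₁, Complex.abs_arg_le_pi_div_two_iff]
  simp
  positivity

theorem theta₁_nonneg : 0 ≤ theta₁ μ := by
  rw [theta₁, Complex.arg_nonneg_iff]
  simp [Real.sqrt_nonneg]

theorem theta₂_eq_neg (hμ : 0 < μ) : theta₂ μ = -theta₁ μ := by
  have h : theta₁ μ ≠ Real.pi := by
    have := (abs_le.1 (abs_theta₁_le hμ)).2
    linarith [Real.pi_pos]
  have h2 := Complex.arg_conj (μ / 2 + Complex.I * (√(1 - μ ^ 2 / 4) : ℝ))
  rw [if_neg (by exact h)] at h2
  rw [theta₁, ← h2, theta₂]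
  congr 1
  simp [sub_eq_add_neg, Complex.conj_ofNat]

theorem exp_I_mul_theta₂ (hμ : 0 < μ) (hμ2 : μ < 2) :
    Complex.exp (Complex.I * theta₂ μ) = μ / 2 - Complex.I * (√(1 - μ ^ 2 / 4) : ℝ) := by
  have h := congrArg (starRingEnd ℂ) (exp_I_mul_theta₁ hμ hμ2)
  rw [← Complex.exp_conj] at h
  rw [theta₂_eq_neg hμ]
  simpa [sub_eq_add_neg, Complex.conj_ofNat] using h

theorem norm_zRoot (θ : ℝ) (j : Fin 4) : ‖zRoot μ θ j‖ = 1 := by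
  have h : ∀ t : ℝ, ‖Complex.exp (Complex.I * (θ + t) / 2)‖ = 1 := by
    intro t
    rw [Complex.norm_exp]
    simp
  fin_cases j <;> simp [zRoot, h]

theorem zRoot_two_sq (hμ : 0 < μ) (hμ2 : μ < 2) (θ : ℝ) :
    zRoot μ θ 2 ^ 2 =
      Complex.exp (Complex.I * θ) * (μ / 2 + Complex.I * (√(1 - μ ^ 2 / 4) : ℝ)) := by
  rw [← exp_I_mul_theta₁ hμ hμ2, ← Complex.exp_add]
  change Complex.exp _ ^ 2 = _
  rw [← Complex.exp_nat_mul]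
  congr 1
  push_cast
  ring

theorem zRoot_three_sq (hμ : 0 < μ) (hμ2 : μ < 2) (θ : ℝ) :
    zRoot μ θ 3 ^ 2 =
      Complex.exp (Complex.I * θ) * (μ / 2 - Complex.I * (√(1 - μ ^ 2 / 4) : ℝ)) := by
  rw [← exp_I_mul_theta₂ hμ hμ2, ← Complex.exp_add]
  change Complex.exp _ ^ 2 = _
  rw [← Complex.exp_nat_mul]
  congr 1
  push_cast
  ring

/-- In the closed right half-plane of spectral parameters the roots keep the distance `α` from the
imaginary axis; the extreme case is the direction `θ = π / 2`. -/
theorem alphaConst_le_re_zRoot (hμ : 0 < μ) {θ : ℝ} (hθ : |θ| ≤ Real.pi / 2) :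
    alphaConst μ ≤ (zRoot μ θ 2).re ∧ alphaConst μ ≤ (zRoot μ θ 3).re := by
  have key : ∀ x : ℝ, (Complex.exp (Complex.I * x / 2)).re = Real.cos (x / 2) := by
    intro x
    rw [← Complex.exp_ofReal_mul_I_re]
    congr 2
    push_cast
    ring
  have hα : alphaConst μ = Real.cos ((Real.pi / 2 + theta₁ μ) / 2) := by
    rw [← key, alphaConst]
    push_cast
    rfl
  have hz2 : (zRoot μ θ 2).re = Real.cos ((θ + theta₁ μ) / 2) := by
    rw [← key]
    push_cast
    rfl
  have hz3 : (zRoot μ θ 3).re = Real.cos ((θ + theta₂ μ) / 2) := by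
    rw [← key]
    push_cast
    rfl
  have h1 := abs_theta₁_le hμ
  have h0 := theta₁_nonneg (μ := μ)
  rw [abs_of_nonneg h0] at h1
  rw [abs_le] at hθ
  have hpi := Real.pi_pos
  rw [hα, hz2, hz3, theta₂_eq_neg hμ, ← Real.cos_abs ((θ + theta₁ μ) / 2),
    ← Real.cos_abs ((θ + -theta₁ μ) / 2)]
  constructor
  · refine Real.cos_le_cos_of_nonneg_of_le_pi (abs_nonneg _) (by linarith) ?_
    rw [abs_le]
    constructor <;> linarith [hθ.1, hθ.2]
  · refine Real.cos_le_cos_of_nonneg_of_le_pi (abs_nonneg _) (by linarith) ?_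
    rw [abs_le]
    constructor <;> linarith [hθ.1, hθ.2]

theorem prod_norm_biquadRoot_sub (ζ η : ℂ) (j : Fin 4) :
    ∏ l ∈ Finset.univ.erase j, ‖biquadRoot ζ η j - biquadRoot ζ η l‖ = ‖biquadDeriv ζ η j‖ := by
  rw [← norm_prod]
  congr 1
  have e0 : (Finset.univ.erase 0 : Finset (Fin 4)) = {1, 2, 3} := by decide
  have e1 : (Finset.univ.erase 1 : Finset (Fin 4)) = {0, 2, 3} := by decide
  have e2 : (Finset.univ.erase 2 : Finset (Fin 4)) = {0, 1, 3} := by decide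
  have e3 : (Finset.univ.erase 3 : Finset (Fin 4)) = {0, 1, 2} := by decide
  fin_cases j <;> simp [e0, e1, e2, e3, biquadRoot, biquadDeriv] <;> ring

theorem norm_biquadDeriv {ζ η : ℂ} {b : ℝ} (hζ : ‖ζ‖ = b) (hη : ‖η‖ = b) (j : Fin 4) :
    ‖biquadDeriv ζ η j‖ = 2 * b * ‖ζ ^ 2 - η ^ 2‖ := by
  have h' := norm_sub_rev (η ^ 2) (ζ ^ 2)
  fin_cases j <;> simp [biquadDeriv, hζ, hη, h']

theorem gProd_eq (hμ : 0 < μ) (hμ2 : μ < 2) (j : Fin 4) :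
    gProd μ j = 4 * √(1 - μ ^ 2 / 4) := by
  have e : zRoot μ 0 2 ^ 2 - zRoot μ 0 3 ^ 2 = 2 * Complex.I * (√(1 - μ ^ 2 / 4) : ℝ) := by
    rw [zRoot_two_sq hμ hμ2, zRoot_three_sq hμ hμ2]
    simp only [Complex.ofReal_zero, mul_zero, Complex.exp_zero, one_mul]
    ring
  rw [show gProd μ j = _ from prod_norm_biquadRoot_sub (zRoot μ 0 2) (zRoot μ 0 3) j,
    norm_biquadDeriv (norm_zRoot 0 2) (norm_zRoot 0 3), e]
  simp only [norm_mul, Complex.norm_ofNat, Complex.norm_I, Complex.norm_real,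
    Real.norm_of_nonneg (Real.sqrt_nonneg _)]
  ring

theorem gProd_pos (hμ : 0 < μ) (hμ2 : μ < 2) (j : Fin 4) : 0 < gProd μ j := by
  rw [gProd_eq hμ hμ2]
  have : 0 < 1 - μ ^ 2 / 4 := by nlinarith
  positivity

/-- The roots `± ζ, ± η` of `z⁴ - λ μ z² + λ²` are the multiples `√|λ| z_j` of the normalized
roots in the direction of `λ`. -/
theorem exists_biquadratic_roots (hμ : 0 < μ) (hμ2 : μ < 2) {lam : ℂ} (hre : 0 ≤ lam.re) :
    ∃ ζ η : ℂ, ‖ζ‖ = √‖lam‖ ∧ ‖η‖ = √‖lam‖ ∧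
      √‖lam‖ * alphaConst μ ≤ ζ.re ∧ √‖lam‖ * alphaConst μ ≤ η.re ∧
      ζ ^ 2 + η ^ 2 = lam * μ ∧ ζ ^ 2 * η ^ 2 = lam ^ 2 ∧
      ∀ j, ‖biquadDeriv ζ η j‖ = √‖lam‖ ^ 3 * gProd μ j := by
  set b := √‖lam‖ with hb
  have hb0 : 0 ≤ b := Real.sqrt_nonneg _
  have hb2 : b ^ 2 = ‖lam‖ := Real.sq_sqrt (norm_nonneg _)
  have hθ : |lam.arg| ≤ Real.pi / 2 := Complex.abs_arg_le_pi_div_two_iff.2 hre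
  obtain ⟨hα2, hα3⟩ := alphaConst_le_re_zRoot hμ hθ
  have h2 := zRoot_two_sq hμ hμ2 lam.arg
  have h3 := zRoot_three_sq hμ hμ2 lam.arg
  have hpolar : (b : ℂ) ^ 2 * Complex.exp (Complex.I * lam.arg) = lam := by
    rw [← Complex.ofReal_pow, hb2, mul_comm Complex.I]
    exact Complex.norm_mul_exp_arg_mul_I lam
  have hs : ((√(1 - μ ^ 2 / 4) : ℝ) : ℂ) ^ 2 = 1 - μ ^ 2 / 4 := by
    rw [← Complex.ofReal_pow, Real.sq_sqrt (by nlinarith)]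
    push_cast
    ring
  have n2 : ‖(b : ℂ) * zRoot μ lam.arg 2‖ = b := by
    rw [norm_mul, norm_zRoot, Complex.norm_real, Real.norm_of_nonneg hb0, mul_one]
  have n3 : ‖(b : ℂ) * zRoot μ lam.arg 3‖ = b := by
    rw [norm_mul, norm_zRoot, Complex.norm_real, Real.norm_of_nonneg hb0, mul_one]
  have s2 : ((b : ℂ) * zRoot μ lam.arg 2) ^ 2
      = lam * (μ / 2 + Complex.I * (√(1 - μ ^ 2 / 4) : ℝ)) := by
    rw [mul_pow, h2, ← mul_assoc, hpolar]
  have s3 : ((b : ℂ) * zRoot μ lam.arg 3) ^ 2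
      = lam * (μ / 2 - Complex.I * (√(1 - μ ^ 2 / 4) : ℝ)) := by
    rw [mul_pow, h3, ← mul_assoc, hpolar]
  refine ⟨b * zRoot μ lam.arg 2, b * zRoot μ lam.arg 3, n2, n3, ?_, ?_, ?_, ?_, fun j => ?_⟩
  · rw [Complex.re_ofReal_mul]; gcongr
  · rw [Complex.re_ofReal_mul]; gcongr
  · rw [s2, s3]; ring
  · rw [s2, s3]
    linear_combination lam ^ 2 * hs - lam ^ 2 * (√(1 - μ ^ 2 / 4) : ℝ) ^ 2 * Complex.I_sq
  · have d : ‖((b : ℂ) * zRoot μ lam.arg 2) ^ 2 - ((b : ℂ) * zRoot μ lam.arg 3) ^ 2‖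
        = b ^ 2 * (2 * √(1 - μ ^ 2 / 4)) := by
      have e : ((b : ℂ) * zRoot μ lam.arg 2) ^ 2 - ((b : ℂ) * zRoot μ lam.arg 3) ^ 2
          = lam * (2 * Complex.I * (√(1 - μ ^ 2 / 4) : ℝ)) := by
        rw [s2, s3]; ring
      rw [e, norm_mul, hb2]
      simp [abs_of_nonneg (Real.sqrt_nonneg _)]
    rw [gProd_eq hμ hμ2, norm_biquadDeriv n2 n3, d]
    ring

end Roots

/-! ### Boundedness of the coefficients along a profile -/

/-- A continuous and bounded function on the line. -/
def IsBoundedContinuous {𝕜 : Type*} [NormedField 𝕜] (f : ℝ → 𝕜) : Prop :=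
  Continuous f ∧ ∃ B : ℝ, ∀ x, ‖f x‖ ≤ B

namespace IsBoundedContinuous

section NormedField

variable {𝕜 : Type*} [NormedField 𝕜] {f g : ℝ → 𝕜}

theorem const (a : 𝕜) : IsBoundedContinuous fun _ => a :=
  ⟨continuous_const, ‖a‖, fun _ => le_rfl⟩

theorem add (hf : IsBoundedContinuous f) (hg : IsBoundedContinuous g) :
    IsBoundedContinuous fun x => f x + g x := by
  obtain ⟨hf, A, hA⟩ := hf
  obtain ⟨hg, B, hB⟩ := hg
  exact ⟨hf.add hg, A + B, fun x => (norm_add_le _ _).trans (add_le_add (hA x) (hB x))⟩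

theorem mul (hf : IsBoundedContinuous f) (hg : IsBoundedContinuous g) :
    IsBoundedContinuous fun x => f x * g x := by
  obtain ⟨hf, A, hA⟩ := hf
  obtain ⟨hg, B, hB⟩ := hg
  refine ⟨hf.mul hg, A * B, fun x => ?_⟩
  rw [norm_mul]
  exact mul_le_mul (hA x) (hB x) (norm_nonneg _) ((norm_nonneg _).trans (hA x))

theorem const_mul (a : 𝕜) (hf : IsBoundedContinuous f) : IsBoundedContinuous fun x => a * f x :=
  (const a).mul hf

theorem sub (hf : IsBoundedContinuous f) (hg : IsBoundedContinuous g) :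
    IsBoundedContinuous fun x => f x - g x := by
  simpa [sub_eq_add_neg] using hf.add (hg.const_mul (-1))

theorem pow (hf : IsBoundedContinuous f) (n : ℕ) : IsBoundedContinuous fun x => f x ^ n := by
  induction n with
  | zero => simpa using const (1 : 𝕜)
  | succ n ih => simpa [pow_succ] using ih.mul hf

end NormedField

variable {f : ℝ → ℝ}

theorem ofReal (hf : IsBoundedContinuous f) : IsBoundedContinuous fun x => (f x : ℂ) := by
  obtain ⟨hf, B, hB⟩ := hf
  refine ⟨Complex.continuous_ofReal.comp hf, B, fun x => ?_⟩
  rw [Complex.norm_real]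
  exact hB x

theorem of_tendsto {a b : ℝ} (hf : Continuous f) (hbot : Tendsto f atBot (𝓝 a))
    (htop : Tendsto f atTop (𝓝 b)) : IsBoundedContinuous f := by
  refine ⟨hf, ?_⟩
  obtain ⟨m, hm⟩ := eventually_atBot.1
    (hbot.abs.eventually (gt_mem_nhds (lt_add_one |a|)))
  obtain ⟨n, hn⟩ := eventually_atTop.1
    (htop.abs.eventually (gt_mem_nhds (lt_add_one |b|)))
  obtain ⟨B, hB⟩ := (isCompact_Icc (a := m) (b := n)).exists_bound_of_continuousOn hf.continuousOn
  refine ⟨max B (max (|a| + 1) (|b| + 1)), fun x => ?_⟩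
  rcases le_total x m with h | h
  · exact (hm x h).le.trans ((le_max_left _ _).trans (le_max_right _ _))
  rcases le_total n x with h' | h'
  · exact (hn x h').le.trans ((le_max_right _ _).trans (le_max_right _ _))
  · exact (hB x ⟨h, h'⟩).trans (le_max_left _ _)

theorem bddAbove (hf : IsBoundedContinuous f) (S : Set ℝ) :
    BddAbove (Set.range fun x : S => |f x|) := by
  obtain ⟨-, B, hB⟩ := hf
  refine ⟨B, ?_⟩
  rintro _ ⟨x, rfl⟩
  exact hB x

theorem abs_le_supAbs (hf : IsBoundedContinuous f) {S : Set ℝ} {x : ℝ} (hx : x ∈ S) :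
    |f x| ≤ supAbs S f :=
  le_ciSup (f := fun x : S => |f x|) (hf.bddAbove S) ⟨x, hx⟩

end IsBoundedContinuous

namespace ShockProfile

variable {γ μ k s : ℝ} (W : ShockProfile γ μ k s)

theorem hasDerivAt_P (x : ℝ) : HasDerivAt W.P (deriv W.P x) x :=
  (W.contDiff_P.differentiable (by norm_num) x).hasDerivAt

theorem hasDerivAt_J (x : ℝ) : HasDerivAt W.J (deriv W.J x) x :=
  (W.contDiff_J.differentiable (by norm_num) x).hasDerivAt

theorem contDiff_deriv_P : ContDiff ℝ 2 (deriv W.P) :=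
  W.contDiff_P.iterate_deriv' 2 1

theorem contDiff_deriv_deriv_P : ContDiff ℝ 1 (deriv (deriv W.P)) :=
  W.contDiff_P.iterate_deriv' 1 2

theorem hasDerivAt_deriv_P (x : ℝ) : HasDerivAt (deriv W.P) (deriv (deriv W.P) x) x :=
  (W.contDiff_deriv_P.differentiable (by norm_num) x).hasDerivAt

theorem deriv_J (x : ℝ) : deriv W.J x = s * deriv W.P x := by
  linear_combination W.mass x

theorem hasDerivAt_deriv_J (x : ℝ) : HasDerivAt (deriv W.J) (s * deriv (deriv W.P) x) x := by
  rw [funext W.deriv_J]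
  exact (W.hasDerivAt_deriv_P x).const_mul s

theorem isBoundedContinuous_J : IsBoundedContinuous W.J :=
  .of_tendsto W.contDiff_J.continuous W.tendsto_J_bot W.tendsto_J_top

theorem isBoundedContinuous_deriv_P : IsBoundedContinuous (deriv W.P) :=
  .of_tendsto W.contDiff_deriv_P.continuous W.tendsto_deriv_P_bot W.tendsto_deriv_P_top

theorem isBoundedContinuous_inv_P : IsBoundedContinuous fun x => (W.P x)⁻¹ :=
  .of_tendsto (W.contDiff_P.continuous.inv₀ fun x => (W.pos x).ne')
    (W.tendsto_P_bot.inv₀ W.Pm_pos.ne') (W.tendsto_P_top.inv₀ W.Pp_pos.ne')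

theorem isBoundedContinuous_rpow_P (e : ℝ) : IsBoundedContinuous fun x => W.P x ^ e :=
  .of_tendsto (W.contDiff_P.continuous.rpow_const fun x => Or.inl (W.pos x).ne')
    (W.tendsto_P_bot.rpow_const (Or.inl W.Pm_pos.ne'))
    (W.tendsto_P_top.rpow_const (Or.inl W.Pp_pos.ne'))

theorem deriv_deriv_log_P (x : ℝ) :
    deriv (deriv fun t => Real.log (W.P t)) x =
      deriv (deriv W.P) x / W.P x - (deriv W.P x / W.P x) ^ 2 := by
  have h1 : (deriv fun t => Real.log (W.P t)) = fun t => deriv W.P t / W.P t :=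
    funext fun t => ((W.hasDerivAt_P t).log (W.pos t).ne').deriv
  have hP := (W.pos x).ne'
  rw [h1, ((W.hasDerivAt_deriv_P x).fun_div (W.hasDerivAt_P x) hP).deriv]
  field_simp

/-- The momentum equation has a first integral, which expresses `P''` by bounded quantities. -/
theorem exists_first_integral : ∃ c : ℝ, ∀ x,
    k ^ 2 / 2 * (deriv (deriv W.P) x - deriv W.P x ^ 2 * (W.P x)⁻¹) =
      -s * W.J x + (W.J x ^ 2 * (W.P x)⁻¹ + W.P x ^ γ) - μ * (s * deriv W.P x) - c := by
  have hψ : (fun x => W.P x * deriv (deriv fun t => Real.log (W.P t)) x)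
      = fun x => deriv (deriv W.P) x - deriv W.P x ^ 2 * (W.P x)⁻¹ := by
    funext x
    rw [W.deriv_deriv_log_P]
    have hP := (W.pos x).ne'
    field_simp
  have hψd : Differentiable ℝ fun x => deriv (deriv W.P) x - deriv W.P x ^ 2 * (W.P x)⁻¹ := by
    refine (W.contDiff_deriv_deriv_P.differentiable (by norm_num)).sub ?_
    exact ((W.contDiff_deriv_P.differentiable (by norm_num)).pow 2).mul
      ((W.contDiff_P.differentiable (by norm_num)).inv fun x => (W.pos x).ne')
  have hφd : Differentiable ℝ fun x => W.J x ^ 2 / W.P x + W.P x ^ γ := by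
    refine Differentiable.add ?_ ?_
    · exact ((W.contDiff_J.differentiable (by norm_num)).pow 2).div
        (W.contDiff_P.differentiable (by norm_num)) fun x => (W.pos x).ne'
    · exact (W.contDiff_P.differentiable (by norm_num)).rpow_const fun x => Or.inl (W.pos x).ne'
  set G : ℝ → ℝ := fun x => -s * W.J x + (W.J x ^ 2 / W.P x + W.P x ^ γ) - μ * deriv W.J x
    - k ^ 2 / 2 * (deriv (deriv W.P) x - deriv W.P x ^ 2 * (W.P x)⁻¹) with hG
  have hGd : ∀ x, HasDerivAt G 0 x := by
    intro x
    have h := ((((W.hasDerivAt_J x).const_mul (-s)).add (hφd x).hasDerivAt).sub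
      ((W.hasDerivAt_deriv_J x).const_mul μ)).sub ((hψd x).hasDerivAt.const_mul (k ^ 2 / 2))
    have hm := W.momentum x
    rw [hψ, (W.hasDerivAt_deriv_J x).deriv] at hm
    refine h.congr_deriv ?_
    linear_combination hm
  refine ⟨G 0, fun x => ?_⟩
  have h0 : G x = G 0 := is_const_of_deriv_eq_zero (fun x => (hGd x).differentiableAt)
    (fun x => (hGd x).deriv) x 0
  rw [← h0, hG]
  simp only [W.deriv_J, div_eq_mul_inv]
  ring

theorem isBoundedContinuous_deriv_deriv_P (hk : k ≠ 0) :
    IsBoundedContinuous (deriv (deriv W.P)) := by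
  obtain ⟨c, hc⟩ := W.exists_first_integral
  have h : deriv (deriv W.P) = fun x => deriv W.P x ^ 2 * (W.P x)⁻¹ + 2 / k ^ 2 *
      (-s * W.J x + (W.J x ^ 2 * (W.P x)⁻¹ + W.P x ^ γ) - μ * (s * deriv W.P x) - c) := by
    funext x
    rw [← hc x]
    field_simp
    ring
  have hP := W.isBoundedContinuous_inv_P
  have hP' := W.isBoundedContinuous_deriv_P
  have hJ := W.isBoundedContinuous_J
  rw [h]
  exact ((hP'.pow 2).mul hP).add ((((((hJ.const_mul _).add (((hJ.pow 2).mul hP).add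
    (W.isBoundedContinuous_rpow_P γ)))).sub ((hP'.const_mul s).const_mul μ)).sub
    (.const c)).const_mul _)

theorem hasDerivAt_f₁ (x : ℝ) : HasDerivAt W.f₁
    (2 * s * (W.J x * deriv W.P x * (W.P x)⁻¹ ^ 2) - 2 * (W.J x ^ 2 * deriv W.P x * (W.P x)⁻¹ ^ 3)
      - γ * (γ - 1) * (W.P x ^ (γ - 1 - 1) * deriv W.P x)) x := by
  have hP := (W.pos x).ne'
  have h := (((W.hasDerivAt_J x).pow 2).div ((W.hasDerivAt_P x).pow 2) (pow_ne_zero 2 hP)).sub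
    (((W.hasDerivAt_P x).rpow_const (p := γ - 1) (Or.inl hP)).const_mul γ)
  refine h.congr_deriv ?_
  rw [W.deriv_J]
  simp only [Pi.pow_apply]
  field_simp
  ring

theorem hasDerivAt_f₂ (x : ℝ) : HasDerivAt W.f₂
    (-2 * (s * (deriv W.P x * (W.P x)⁻¹) - W.J x * deriv W.P x * (W.P x)⁻¹ ^ 2)) x := by
  have hP := (W.pos x).ne'
  have h := (((W.hasDerivAt_J x).div (W.hasDerivAt_P x) hP).const_mul 2).const_sub s
  refine h.congr_deriv ?_
  rw [W.deriv_J]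
  field_simp

theorem isBoundedContinuous_f₁ : IsBoundedContinuous W.f₁ := by
  have h := ((W.isBoundedContinuous_J.pow 2).mul (W.isBoundedContinuous_inv_P.pow 2)).sub
    ((W.isBoundedContinuous_rpow_P (γ - 1)).const_mul γ)
  simp only [inv_pow, ← div_eq_mul_inv] at h
  exact h

theorem isBoundedContinuous_f₂ : IsBoundedContinuous W.f₂ := by
  have h := (IsBoundedContinuous.const s).sub
    ((W.isBoundedContinuous_J.mul W.isBoundedContinuous_inv_P).const_mul 2)
  simp only [← div_eq_mul_inv] at h
  exact h

theorem isBoundedContinuous_deriv_f₁ : IsBoundedContinuous (deriv W.f₁) := by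
  have hP := W.isBoundedContinuous_inv_P
  have hP' := W.isBoundedContinuous_deriv_P
  have hJ := W.isBoundedContinuous_J
  rw [funext fun x => (W.hasDerivAt_f₁ x).deriv]
  exact ((((hJ.mul hP').mul (hP.pow 2)).const_mul _).sub
    ((((hJ.pow 2).mul hP').mul (hP.pow 3)).const_mul _)).sub
    (((W.isBoundedContinuous_rpow_P _).mul hP').const_mul _)

theorem isBoundedContinuous_deriv_f₂ : IsBoundedContinuous (deriv W.f₂) := by
  have hP := W.isBoundedContinuous_inv_P
  have hP' := W.isBoundedContinuous_deriv_P
  have hJ := W.isBoundedContinuous_J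
  rw [funext fun x => (W.hasDerivAt_f₂ x).deriv]
  exact (((hP'.mul hP).const_mul _).sub ((hJ.mul hP').mul (hP.pow 2))).const_mul _

theorem isBoundedContinuous_f₃ (hk : k ≠ 0) : IsBoundedContinuous W.f₃ := by
  have hP := W.isBoundedContinuous_inv_P
  have hP' := W.isBoundedContinuous_deriv_P
  have h := ((((hP'.mul (W.isBoundedContinuous_deriv_deriv_P hk)).mul (hP.pow 2)).sub
    ((hP'.mul hP).pow 3)).const_mul (k ^ 2))
  simp only [inv_pow, ← div_eq_mul_inv] at h
  exact h

theorem isBoundedContinuous_f₄ (hk : k ≠ 0) : IsBoundedContinuous W.f₄ := by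
  have hP := W.isBoundedContinuous_inv_P
  have hP' := W.isBoundedContinuous_deriv_P
  have h := ((((hP'.mul hP).pow 2).const_mul (3 / 2)).sub
    ((W.isBoundedContinuous_deriv_deriv_P hk).mul hP)).const_mul (k ^ 2)
  simp only [← div_eq_mul_inv] at h
  exact h

theorem isBoundedContinuous_f₅ : IsBoundedContinuous W.f₅ := by
  have h := (W.isBoundedContinuous_deriv_P.mul W.isBoundedContinuous_inv_P).const_mul (-k ^ 2)
  simp only [← div_eq_mul_inv] at h
  exact h

end ShockProfile

/-! ### The Lyapunov form of the eigenvalue equation -/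

theorem supAbs_nonneg (S : Set ℝ) (g : ℝ → ℝ) : 0 ≤ supAbs S g :=
  Real.iSup_nonneg fun _ => abs_nonneg _

theorem sq_rpow_eq_inv_pow {b e : ℝ} (hb : 0 ≤ b) (n : ℕ) (he : 2 * e = -n) :
    (b ^ 2) ^ e = (b ^ n)⁻¹ := by
  rw [← Real.rpow_natCast b 2, ← Real.rpow_mul hb]
  push_cast
  rw [he, Real.rpow_neg hb, Real.rpow_natCast]

theorem isBoundedSystem_companion4 {a₀ a₁ a₂ a₃ : ℝ → ℂ} (h₀ : IsBoundedContinuous a₀)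
    (h₁ : IsBoundedContinuous a₁) (h₂ : IsBoundedContinuous a₂) (h₃ : IsBoundedContinuous a₃) :
    ∃ K, IsBoundedSystem (fun x => companion4 (a₀ x) (a₁ x) (a₂ x) (a₃ x)) K := by
  have hent : ∀ i j, IsBoundedContinuous fun x => companion4 (a₀ x) (a₁ x) (a₂ x) (a₃ x) i j := by
    have hneg : ∀ {a : ℝ → ℂ}, IsBoundedContinuous a → IsBoundedContinuous fun x => -a x :=
      fun h => by simpa using h.const_mul (-1)
    intro i j
    fin_cases i <;> fin_cases j <;>
      first
      | exact IsBoundedContinuous.const 0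
      | exact IsBoundedContinuous.const 1
      | exact hneg h₀
      | exact hneg h₁
      | exact hneg h₂
      | exact hneg h₃
  choose hc B hB using hent
  have hB0 : ∀ i j, 0 ≤ B i j := fun i j => (norm_nonneg _).trans (hB i j 0)
  refine ⟨∑ i, ∑ j, B i j, continuous_matrix hc, fun x u => ?_⟩
  have hK : 0 ≤ ∑ i, ∑ j, B i j :=
    Finset.sum_nonneg fun i _ => Finset.sum_nonneg fun j _ => hB0 i j
  refine (pi_norm_le_iff_of_nonneg (by positivity)).2 fun i => ?_
  calc ‖(companion4 (a₀ x) (a₁ x) (a₂ x) (a₃ x)).mulVec u i‖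
      ≤ ∑ j, ‖companion4 (a₀ x) (a₁ x) (a₂ x) (a₃ x) i j * u j‖ :=
        norm_sum_le Finset.univ fun j => companion4 (a₀ x) (a₁ x) (a₂ x) (a₃ x) i j * u j
    _ ≤ ∑ j, B i j * ‖u‖ := by
        refine Finset.sum_le_sum fun j _ => ?_
        rw [norm_mul]
        exact mul_le_mul (hB i j x) (norm_le_pi_norm u j) (norm_nonneg _) (hB0 i j)
    _ = (∑ j, B i j) * ‖u‖ := by rw [Finset.sum_mul]
    _ ≤ (∑ i, ∑ j, B i j) * ‖u‖ := by
        refine mul_le_mul_of_nonneg_right ?_ (norm_nonneg u)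
        exact Finset.single_le_sum (f := fun i => ∑ j, B i j)
          (fun i _ => Finset.sum_nonneg fun j _ => hB0 i j) (Finset.mem_univ i)

namespace ShockProfile

section Bounds

variable {γ μ k s : ℝ} (W : ShockProfile γ μ k s)

theorem mBound_antitone (S : Set ℝ) {a C : ℝ} (hC : 0 < C) (ha : C ≤ a) (l : Fin 4) :
    W.mBound S a l ≤ W.mBound S C l := by
  have h := supAbs_nonneg S
  have hr : ∀ e : ℝ, e ≤ 0 → a ^ e ≤ C ^ e := fun e he =>
    Real.rpow_le_rpow_of_nonpos hC ha he
  fin_cases l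
  · exact mul_le_mul_of_nonneg_right (hr _ (by norm_num)) (h _)
  · exact add_le_add (mul_le_mul_of_nonneg_right (hr _ (by norm_num)) (h _))
      (mul_le_mul_of_nonneg_right (hr _ (by norm_num)) (h _))
  · exact mul_le_mul_of_nonneg_right (hr _ (by norm_num)) (h _)
  · exact mul_le_mul_of_nonneg_right (hr _ (by norm_num)) (h _)

/-- The part of the coefficients of the eigenvalue equation, with `2 / k² = 1`, that is of lower
order in `λ`: what remains after the constant coefficients of `z⁴ - λ μ z² + λ²` are removed. -/
def lowerOrder (lam : ℂ) (x : ℝ) : Fin 4 → ℂ :=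
  ![-lam * deriv W.f₂ x,
    deriv W.f₁ x + deriv W.f₂ x * s - lam * W.f₂ x + W.f₃ x - s * lam,
    W.f₁ x + W.f₂ x * s + W.f₄ x,
    s * μ + W.f₅ x]

/-- The lower order coefficients in the scaling `z ~ √|λ|`. -/
theorem norm_lowerOrder_le (hk : k ≠ 0) {S : Set ℝ} {x : ℝ} (hx : x ∈ S) {lam : ℂ} {b : ℝ}
    (hb : 0 < b) (hlam : ‖lam‖ = b ^ 2) (l : Fin 4) :
    ‖W.lowerOrder lam x l‖ * b ^ (l : ℕ) ≤ b ^ 4 * W.mBound S (b ^ 2) l := by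
  have r1 : (b ^ 2) ^ (-1 : ℝ) = (b ^ 2)⁻¹ := sq_rpow_eq_inv_pow hb.le 2 (by norm_num)
  have r3 : (b ^ 2) ^ (-(3 / 2) : ℝ) = (b ^ 3)⁻¹ := sq_rpow_eq_inv_pow hb.le 3 (by norm_num)
  have r2 : (b ^ 2) ^ (-(1 / 2) : ℝ) = (b ^ 1)⁻¹ := sq_rpow_eq_inv_pow hb.le 1 (by norm_num)
  have b1 := W.isBoundedContinuous_f₁
  have b2 := W.isBoundedContinuous_f₂
  have c1 := W.isBoundedContinuous_deriv_f₁
  have c2 := W.isBoundedContinuous_deriv_f₂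
  have b3 := W.isBoundedContinuous_f₃ hk
  have b4 := W.isBoundedContinuous_f₄ hk
  have b5 := W.isBoundedContinuous_f₅
  fin_cases l
  · change ‖-lam * deriv W.f₂ x‖ * b ^ 0 ≤ b ^ 4 * ((b ^ 2) ^ (-1 : ℝ) * supAbs S (deriv W.f₂))
    have h := c2.abs_le_supAbs hx
    rw [r1, norm_mul, norm_neg, hlam, Complex.norm_real, Real.norm_eq_abs]
    calc b ^ 2 * |deriv W.f₂ x| * b ^ 0 ≤ b ^ 2 * supAbs S (deriv W.f₂) * b ^ 0 := by gcongr
      _ = _ := by field_simp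
  · change ‖deriv W.f₁ x + deriv W.f₂ x * s - lam * W.f₂ x + W.f₃ x - s * lam‖ * b ^ 1 ≤
      b ^ 4 * ((b ^ 2) ^ (-(3 / 2) : ℝ) *
        supAbs S (fun x => deriv W.f₁ x + s * deriv W.f₂ x + W.f₃ x)
      + (b ^ 2) ^ (-(1 / 2) : ℝ) * supAbs S (fun x => W.f₂ x + s))
    have h := ((c1.add (c2.const_mul s)).add b3).abs_le_supAbs hx
    have h' := (b2.add (.const s)).abs_le_supAbs hx
    have e : (deriv W.f₁ x + deriv W.f₂ x * s - lam * W.f₂ x + W.f₃ x - s * lam : ℂ)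
        = ((deriv W.f₁ x + s * deriv W.f₂ x + W.f₃ x : ℝ) : ℂ)
          - lam * ((W.f₂ x + s : ℝ) : ℂ) := by
      push_cast; ring
    rw [r2, r3, e]
    calc _ ≤ (supAbs S (fun x => deriv W.f₁ x + s * deriv W.f₂ x + W.f₃ x)
          + b ^ 2 * supAbs S (fun x => W.f₂ x + s)) * b ^ 1 := by
          gcongr
          refine (norm_sub_le _ _).trans (add_le_add ?_ ?_)
          · rw [Complex.norm_real, Real.norm_eq_abs]
            exact h
          · rw [norm_mul, hlam, Complex.norm_real, Real.norm_eq_abs]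
            gcongr
      _ = _ := by field_simp
  · change ‖(W.f₁ x + W.f₂ x * s + W.f₄ x : ℂ)‖ * b ^ 2 ≤
      b ^ 4 * ((b ^ 2) ^ (-1 : ℝ) * supAbs S (fun x => W.f₁ x + s * W.f₂ x + W.f₄ x))
    have h := ((b1.add (b2.const_mul s)).add b4).abs_le_supAbs hx
    have e : (W.f₁ x + W.f₂ x * s + W.f₄ x : ℂ) = ((W.f₁ x + s * W.f₂ x + W.f₄ x : ℝ) : ℂ) := by
      push_cast; ring
    rw [r1, e, Complex.norm_real, Real.norm_eq_abs]
    calc _ ≤ supAbs S (fun x => W.f₁ x + s * W.f₂ x + W.f₄ x) * b ^ 2 := by gcongr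
      _ = _ := by field_simp
  · change ‖(s * μ + W.f₅ x : ℂ)‖ * b ^ 3 ≤
      b ^ 4 * ((b ^ 2) ^ (-(1 / 2) : ℝ) * supAbs S (fun x => s * μ + W.f₅ x))
    have h := ((IsBoundedContinuous.const (s * μ)).add b5).abs_le_supAbs hx
    have e : (s * μ + W.f₅ x : ℂ) = ((s * μ + W.f₅ x : ℝ) : ℂ) := by push_cast; ring
    rw [r2, e, Complex.norm_real, Real.norm_eq_abs]
    calc _ ≤ supAbs S (fun x => s * μ + W.f₅ x) * b ^ 3 := by gcongr
      _ = _ := by field_simp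

/-- In mode coordinates the lower order terms have Frobenius norm at most `√|λ| δ(C)`. -/
theorem sqrt_sum_perturbation_le (hμ : 0 < μ) (hμ2 : μ < 2) (hk : k ≠ 0) {S : Set ℝ} {x : ℝ}
    (hx : x ∈ S) {lam : ℂ} {b C : ℝ} (hb : 0 < b) (hlam : ‖lam‖ = b ^ 2) (hC : 0 < C)
    (hCb : C ≤ b ^ 2) {ζ η : ℂ} (hζ : ‖ζ‖ = b) (hη : ‖η‖ = b)
    (hd : ∀ j, ‖biquadDeriv ζ η j‖ = b ^ 3 * gProd μ j) :
    √(∑ j, ∑ i, ‖-(∑ l, W.lowerOrder lam x l * biquadRoot ζ η i ^ (l : ℕ)) /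
      biquadDeriv ζ η j‖ ^ 2) ≤ b * W.deltaConst S C := by
  have hroot : ∀ i, ‖biquadRoot ζ η i‖ = b := by
    intro i
    fin_cases i <;> simp [biquadRoot, hζ, hη]
  have key : ∀ j i, ‖-(∑ l, W.lowerOrder lam x l * biquadRoot ζ η i ^ (l : ℕ)) /
      biquadDeriv ζ η j‖ ≤ b * W.residualMatrix S C j i := by
    intro j i
    have hg := gProd_pos hμ hμ2 j
    have h1 : ‖∑ l, W.lowerOrder lam x l * biquadRoot ζ η i ^ (l : ℕ)‖
        ≤ b ^ 4 * ∑ l, W.mBound S C l := by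
      rw [Finset.mul_sum]
      refine (norm_sum_le _ _).trans (Finset.sum_le_sum fun l _ => ?_)
      rw [norm_mul, norm_pow, hroot]
      refine (W.norm_lowerOrder_le hk hx hb hlam l).trans ?_
      gcongr
      exact W.mBound_antitone S hC hCb l
    have h2 : W.residualMatrix S C j i = (∑ l, W.mBound S C l) / gProd μ j := by
      simp [residualMatrix, norm_zRoot]
    rw [norm_div, norm_neg, hd, h2]
    calc _ ≤ b ^ 4 * (∑ l, W.mBound S C l) / (b ^ 3 * gProd μ j) := by gcongr
      _ = _ := by field_simp
  calc _ ≤ √(∑ j, ∑ i, (b * W.residualMatrix S C j i) ^ 2) := by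
        gcongr with j _ i _
        exact key j i
    _ = _ := by
        simp only [mul_pow, ← Finset.mul_sum]
        rw [Real.sqrt_mul (sq_nonneg b), Real.sqrt_sq hb.le]
        rfl

theorem isBoundedSystem_scalarSystem (hk : k ≠ 0) (lam : ℂ) :
    ∃ K, IsBoundedSystem (W.scalarSystem lam) K := by
  have b1 := W.isBoundedContinuous_f₁.ofReal
  have b2 := W.isBoundedContinuous_f₂.ofReal
  have c1 := W.isBoundedContinuous_deriv_f₁.ofReal
  have c2 := W.isBoundedContinuous_deriv_f₂.ofReal
  have b3 := (W.isBoundedContinuous_f₃ hk).ofReal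
  have b4 := (W.isBoundedContinuous_f₄ hk).ofReal
  have b5 := W.isBoundedContinuous_f₅.ofReal
  exact isBoundedSystem_companion4
    (((c2.const_mul (-lam)).add (.const (lam ^ 2))).const_mul _)
    (((((c1.add (c2.mul (.const (s : ℂ)))).sub (b2.const_mul lam)).add b3).sub
      (.const (s * lam))).const_mul _)
    (((((b1.add (b2.mul (.const (s : ℂ)))).add b4).sub (.const (lam * μ)))).const_mul _)
    (((IsBoundedContinuous.const (s * μ : ℂ)).add b5).const_mul _)

end Bounds

section Lyapunov

variable {γ μ s : ℝ} (W : ShockProfile γ μ (√2) s)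

theorem scalarSystem_eq_companion4 {lam ζ η : ℂ} (h1 : ζ ^ 2 + η ^ 2 = lam * μ)
    (h2 : ζ ^ 2 * η ^ 2 = lam ^ 2) (x : ℝ) :
    W.scalarSystem lam x =
      companion4 (ζ ^ 2 * η ^ 2 + W.lowerOrder lam x 0) (W.lowerOrder lam x 1)
        (-(ζ ^ 2 + η ^ 2) + W.lowerOrder lam x 2) (W.lowerOrder lam x 3) := by
  have hk : (2 / ((√2 : ℝ) : ℂ) ^ 2) = 1 := by
    rw [← Complex.ofReal_pow, Real.sq_sqrt (by norm_num)]
    norm_num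
  rw [scalarSystem, hk, h1, h2]
  simp only [lowerOrder, one_mul, Matrix.cons_val]
  congr 1 <;> ring

/-- Where `δ < α` on both half-lines, the form "unstable minus stable part" in the coordinates that
diagonalize the leading part grows along the solutions of the eigenvalue equation. -/
theorem exists_isLyapunovForm_scalarSystem (hμ : 0 < μ) (hμ2 : μ < 2) {C : ℝ} (hC : 0 < C)
    (hδp : W.deltaConst (Set.Ici 0) C < alphaConst μ)
    (hδm : W.deltaConst (Set.Iic 0) C < alphaConst μ)
    {lam : ℂ} (hre : 0 ≤ lam.re) (hlam : C ≤ ‖lam‖) :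
    ∃ (L V : Matrix (Fin 4) (Fin 4) ℂ) (c : ℝ), V * L = 1 ∧
      IsLyapunovForm (W.scalarSystem lam) (modeForm L) c := by
  obtain ⟨ζ, η, hζ, hη, hζre, hηre, hsum, hprod, hd⟩ := exists_biquadratic_roots hμ hμ2 hre
  have hk : √(2 : ℝ) ≠ 0 := by positivity
  have hb : 0 < √‖lam‖ := Real.sqrt_pos.2 (hC.trans_le hlam)
  have hb2 : ‖lam‖ = √‖lam‖ ^ 2 := (Real.sq_sqrt (norm_nonneg _)).symm
  set b := √‖lam‖ with hbdef
  have hζ0 : ζ ≠ 0 := norm_ne_zero_iff.1 (hζ ▸ hb.ne')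
  have hη0 : η ≠ 0 := norm_ne_zero_iff.1 (hη ▸ hb.ne')
  have hne : ζ ^ 2 - η ^ 2 ≠ 0 := by
    intro h
    have h1 := norm_biquadDeriv hζ hη 0
    have h2 := gProd_pos hμ hμ2 0
    rw [h, norm_zero, mul_zero, hd] at h1
    have : 0 < b ^ 3 * gProd μ 0 := by positivity
    linarith
  have hVL := vandermonde_mul_modeMatrix hζ0 hη0 hne
  have hδ : b * max (W.deltaConst (Set.Ici 0) C) (W.deltaConst (Set.Iic 0) C)
      < b * alphaConst μ := mul_lt_mul_of_pos_left (max_lt hδp hδm) hb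
  have hR : ∀ x, √(∑ j, ∑ i, ‖-(∑ l, W.lowerOrder lam x l * biquadRoot ζ η i ^ (l : ℕ)) /
      biquadDeriv ζ η j‖ ^ 2) ≤
        b * max (W.deltaConst (Set.Ici 0) C) (W.deltaConst (Set.Iic 0) C) := by
    intro x
    rcases le_total 0 x with hx | hx
    · refine (W.sqrt_sum_perturbation_le hμ hμ2 hk (S := Set.Ici 0) hx hb hb2 hC (hb2 ▸ hlam)
        hζ hη hd).trans ?_
      gcongr
      exact le_max_left _ _
    · refine (W.sqrt_sum_perturbation_le hμ hμ2 hk (S := Set.Iic 0) hx hb hb2 hC (hb2 ▸ hlam)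
        hζ hη hd).trans ?_
      gcongr
      exact le_max_right _ _
  have hdiag : ∀ x, IsPerturbedDiagonal (modeMatrix ζ η) (W.scalarSystem lam x) (biquadRoot ζ η)
      (fun j i => -(∑ l, W.lowerOrder lam x l * biquadRoot ζ η i ^ (l : ℕ)) /
        biquadDeriv ζ η j) := fun x => by
    rw [W.scalarSystem_eq_companion4 hsum hprod]
    exact isPerturbedDiagonal_companion4 hζ0 hη0 hne _
  obtain ⟨c, hc⟩ := exists_isLyapunovForm_modeForm hVL hdiag
    (by simpa [biquadRoot] using hζre) (by simpa [biquadRoot] using hηre) hζre hηre hR hδ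
  exact ⟨_, _, c, hVL, hc⟩

end Lyapunov

end ShockProfile

/-! ### Eigenfunctions and the integrated density -/

theorem memLp_two_integrable_sq {f : ℝ → ℂ} (h : MemLp f 2 volume) :
    Integrable fun x => ‖f x‖ ^ 2 :=
  (memLp_two_iff_integrable_sq_norm h.aestronglyMeasurable).1 h

namespace ShockProfile

variable {γ μ k s : ℝ} (W : ShockProfile γ μ k s)

theorem hasDerivAt_logDeriv_P (x : ℝ) : HasDerivAt (fun y => deriv W.P y / W.P y)
    (deriv (deriv W.P) x / W.P x - (deriv W.P x / W.P x) ^ 2) x := by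
  have hP := (W.pos x).ne'
  refine ((W.hasDerivAt_deriv_P x).fun_div (W.hasDerivAt_P x) hP).congr_deriv ?_
  field_simp

/-- The product under the derivative in the quantum term of the linearization, in terms of
`P' / P`. -/
theorem deriv_sqrt_P_mul_deriv {r : ℝ → ℂ} (hr : Differentiable ℝ r) (y : ℝ) :
    ((deriv (fun t => √(W.P t)) y : ℝ) : ℂ) * deriv (fun t => r t / ((√(W.P t) : ℝ) : ℂ)) y =
      ((deriv W.P y / W.P y : ℝ) : ℂ) / 2 * deriv r y
        - ((deriv W.P y / W.P y : ℝ) : ℂ) ^ 2 / 4 * r y := by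
  have hP := W.pos y
  have hσ : HasDerivAt (fun t => √(W.P t)) (deriv W.P y / (2 * √(W.P y))) y :=
    (W.hasDerivAt_P y).sqrt hP.ne'
  have hσ0 : ((√(W.P y) : ℝ) : ℂ) ≠ 0 := by
    exact_mod_cast (Real.sqrt_pos.2 hP).ne'
  have hP2 : ((W.P y : ℝ) : ℂ) = ((√(W.P y) : ℝ) : ℂ) ^ 2 := by
    rw [← Complex.ofReal_pow, Real.sq_sqrt hP.le]
  rw [hσ.deriv, ((hr y).hasDerivAt.fun_div hσ.ofReal_comp hσ0).deriv]
  push_cast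
  rw [hP2]
  field_simp
  ring

/-- The quantum term of the linearization, without its leading part `k² / 2 r'''`, has the
coefficients `f₃, f₄, f₅`. -/
theorem bohm_linearization {r : ℝ → ℂ} (hr : ContDiff ℝ 3 r) (x : ℝ) :
    -2 * (k : ℂ) ^ 2 * deriv (fun y => ((deriv (fun t => √(W.P t)) y : ℝ) : ℂ)
      * deriv (fun t => r t / ((√(W.P t) : ℝ) : ℂ)) y) x =
      W.f₃ x * r x + W.f₄ x * deriv r x + W.f₅ x * deriv (deriv r) x := by
  have hr1 : ContDiff ℝ 2 (deriv r) := hr.iterate_deriv' 2 1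
  have hq := (W.hasDerivAt_logDeriv_P x).ofReal_comp
  have h0 : HasDerivAt r (deriv r x) x := (hr.differentiable (by norm_num) x).hasDerivAt
  have h1 : HasDerivAt (deriv r) (deriv (deriv r) x) x :=
    (hr1.differentiable (by norm_num) x).hasDerivAt
  rw [funext (W.deriv_sqrt_P_mul_deriv (hr.differentiable (by norm_num)))]
  have h := ((hq.div_const 2).fun_mul h1).fun_sub (((hq.fun_pow 2).div_const 4).fun_mul h0)
  rw [h.deriv]
  have hP : ((W.P x : ℝ) : ℂ) ≠ 0 := by exact_mod_cast (W.pos x).ne'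
  simp only [f₃, f₄, f₅]
  push_cast
  field_simp
  ring

/-- The pressure and convection terms of the linearization have the coefficients `f₁, f₂`. -/
theorem flux_linearization {r j : ℝ → ℂ} (hr : Differentiable ℝ r) (hj : Differentiable ℝ j)
    (x : ℝ) :
    deriv (fun y => ((W.J y ^ 2 / W.P y ^ 2 : ℝ) : ℂ) * r y) x
        - deriv (fun y => ((2 * W.J y / W.P y : ℝ) : ℂ) * j y) x
        - γ * deriv (fun y => ((W.P y ^ (γ - 1) : ℝ) : ℂ) * r y) x =
      (deriv W.f₁ x * r x + W.f₁ x * deriv r x)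
        + (deriv W.f₂ x * j x + (W.f₂ x - s) * deriv j x) := by
  have hP := (W.pos x).ne'
  have hA := ((W.hasDerivAt_J x).fun_pow 2).fun_div ((W.hasDerivAt_P x).fun_pow 2)
    (pow_ne_zero 2 hP)
  have hB := (W.hasDerivAt_P x).rpow_const (p := γ - 1) (Or.inl hP)
  have hf₁ : deriv W.f₁ x = _ := (hA.fun_sub (hB.const_mul γ)).deriv
  have hf₂ : HasDerivAt (fun y => 2 * W.J y / W.P y) (-deriv W.f₂ x) x := by
    have h := (W.hasDerivAt_f₂ x).differentiableAt.hasDerivAt.const_sub s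
    refine h.congr_of_eventuallyEq (Eventually.of_forall fun y => ?_)
    simp only [f₂]
    ring
  have h0 := (hr x).hasDerivAt
  rw [(hA.ofReal_comp.fun_mul h0).deriv, (hB.ofReal_comp.fun_mul h0).deriv,
    (hf₂.ofReal_comp.fun_mul (hj x).hasDerivAt).deriv, hf₁]
  simp only [f₁, f₂]
  push_cast
  ring

/-- An eigenfunction `(r, j)` yields a solution of the scalar eigenvalue equation that decays at
both ends: the mass equation makes `(s r - j) / λ` a square integrable primitive of `r`, and the
momentum equation becomes the fourth-order equation for this primitive. -/
theorem IsEigenvalue.exists_mem_decaySpace {W : ShockProfile γ μ k s} (hk : k ≠ 0) {lam : ℂ}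
    (hlam : lam ≠ 0) (h : W.IsEigenvalue lam) :
    ∃ Y, Y ≠ 0 ∧ Y ∈ decaySpace (W.scalarSystem lam) atBot ∧
      Y ∈ decaySpace (W.scalarSystem lam) atTop := by
  obtain ⟨r, j, hr, hj, hrL, hjL, hne, hmass, hmom⟩ := h
  set u : ℝ → ℂ := fun x => lam⁻¹ * (s * r x - j x) with hu
  have hrd : Differentiable ℝ r := hr.differentiable (by norm_num)
  have hjd : Differentiable ℝ j := hj.differentiable (by norm_num)
  have hr1 : ContDiff ℝ 2 (deriv r) := hr.iterate_deriv' 2 1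
  have hr2 : ContDiff ℝ 1 (deriv (deriv r)) := hr.iterate_deriv' 1 2
  have hr3 : ContDiff ℝ 0 (deriv (deriv (deriv r))) := hr.iterate_deriv' 0 3
  have d0 : ∀ x, HasDerivAt u (r x) x := fun x => by
    have h := (((hrd x).hasDerivAt.const_mul (s : ℂ)).sub (hjd x).hasDerivAt).const_mul lam⁻¹
    refine h.congr_deriv ?_
    rw [← hmass x, inv_mul_cancel_left₀ hlam]
  have d1 : ∀ x, HasDerivAt r (deriv r x) x := fun x => (hrd x).hasDerivAt
  have d2 : ∀ x, HasDerivAt (deriv r) (deriv (deriv r) x) x := fun x =>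
    (hr1.differentiable (by norm_num) x).hasDerivAt
  have d3 : ∀ x, HasDerivAt (deriv (deriv r)) (deriv (deriv (deriv r)) x) x := fun x =>
    (hr2.differentiable (by norm_num) x).hasDerivAt
  have hj0 : ∀ x, j x = s * r x - lam * u x := fun x => by
    rw [hu]
    field_simp
    ring
  have hj1 : deriv j = fun x => s * deriv r x - lam * r x := funext fun x => by
    linear_combination hmass x
  have hj2 : ∀ x, deriv (deriv j) x = s * deriv (deriv r) x - lam * deriv r x := fun x => by
    rw [hj1]
    exact (((d2 x).const_mul (s : ℂ)).sub ((d1 x).const_mul lam)).deriv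
  set Y : ℝ → Fin 4 → ℂ := fun x => ![u x, r x, deriv r x, deriv (deriv r) x] with hY
  have hsol : ∀ x, HasDerivAt Y ((W.scalarSystem lam x).mulVec (Y x)) x := by
    intro x
    have heq : deriv (deriv (deriv r)) x = (W.scalarSystem lam x).mulVec (Y x) 3 := by
      have hm := hmom x
      have hb := W.bohm_linearization hr x
      have hf := W.flux_linearization hrd hjd x
      rw [hj2, hj1] at hm
      rw [hj1] at hf
      rw [hj0] at hm hf
      have hk' : (k : ℂ) ≠ 0 := by exact_mod_cast hk
      have hk2 : (2 / (k : ℂ) ^ 2) * ((k : ℂ) ^ 2 / 2) = 1 := by field_simp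
      simp only [hY, scalarSystem, companion4, Matrix.mulVec, dotProduct, Fin.sum_univ_four,
        Matrix.of_apply, Matrix.cons_val]
      linear_combination (-(2 / (k : ℂ) ^ 2)) * (hm + hf + hb)
        + (-deriv (deriv (deriv r)) x) * hk2
    rw [hasDerivAt_pi]
    intro i
    fin_cases i
    · simpa [scalarSystem, companion4, Matrix.mulVec, dotProduct, Fin.sum_univ_four, hY] using d0 x
    · simpa [scalarSystem, companion4, Matrix.mulVec, dotProduct, Fin.sum_univ_four, hY] using d1 x
    · simpa [scalarSystem, companion4, Matrix.mulVec, dotProduct, Fin.sum_univ_four, hY] using d2 x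
    · exact heq ▸ d3 x
  have l1 : MemLp r 2 volume := by simpa [iteratedDeriv_eq_iterate] using hrL 0 (by norm_num)
  have l2 : MemLp (deriv r) 2 volume := by
    simpa [iteratedDeriv_eq_iterate] using hrL 1 (by norm_num)
  have l3 : MemLp (deriv (deriv r)) 2 volume := by
    simpa [iteratedDeriv_eq_iterate] using hrL 2 (by norm_num)
  have l4 : MemLp (deriv (deriv (deriv r))) 2 volume := by
    simpa [iteratedDeriv_eq_iterate] using hrL 3 (by norm_num)
  have lj : MemLp j 2 volume := by simpa [iteratedDeriv_eq_iterate] using hjL 0 (by norm_num)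
  have l0 : MemLp u 2 volume := ((l1.const_mul (s : ℂ)).sub lj).const_mul lam⁻¹
  have i0 := memLp_two_integrable_sq l0
  have i1 := memLp_two_integrable_sq l1
  have i2 := memLp_two_integrable_sq l2
  have i3 := memLp_two_integrable_sq l3
  have i4 := memLp_two_integrable_sq l4
  refine ⟨Y, fun h0 => ?_, ⟨hsol, ?_⟩, ⟨hsol, ?_⟩⟩
  · have hu0 : ∀ x, u x = 0 := fun x => congrFun (congrFun h0 x) 0
    have hr0 : ∀ x, r x = 0 := fun x => congrFun (congrFun h0 x) 1
    rcases hne with h | h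
    · exact h (funext hr0)
    · exact h (funext fun x => by rw [hj0, hr0, hu0]; simp)
  · rw [tendsto_pi_nhds]
    intro i
    fin_cases i
    · exact tendsto_atBot_zero_of_integrable_norm_sq d0 hr.continuous i0 i1
    · exact tendsto_atBot_zero_of_integrable_norm_sq d1 hr1.continuous i1 i2
    · exact tendsto_atBot_zero_of_integrable_norm_sq d2 hr2.continuous i2 i3
    · exact tendsto_atBot_zero_of_integrable_norm_sq d3 hr3.continuous i3 i4
  · rw [tendsto_pi_nhds]
    intro i
    fin_cases i
    · exact tendsto_atTop_zero_of_integrable_norm_sq d0 hr.continuous i0 i1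
    · exact tendsto_atTop_zero_of_integrable_norm_sq d1 hr1.continuous i1 i2
    · exact tendsto_atTop_zero_of_integrable_norm_sq d2 hr2.continuous i2 i3
    · exact tendsto_atTop_zero_of_integrable_norm_sq d3 hr3.continuous i3 i4

end ShockProfile

end

/-! ### The Evans function in the right half-plane -/

theorem mainTheorem3 (γ μ s : ℝ) (hγ : 1 ≤ γ) (hμ : 0 < μ) (hμ2 : μ < 2)
    (W : ShockProfile γ μ (√2) s) (C : ℝ) (hC : 0 < C)
    (hδp : W.deltaConst (Set.Ici 0) C < alphaConst μ / 4)
    (hδm : W.deltaConst (Set.Iic 0) C < alphaConst μ / 4)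
    (hε : √2 * √(W.epsConst (Set.Ici 0) C ^ 2 + W.epsConst (Set.Iic 0) C ^ 2) < 1)
    (lam : ℂ) (hre : 0 ≤ lam.re) (hlam : C ≤ ‖lam‖) :
    (∃ Y, IsEvansFrame (W.scalarSystem lam) Y) ∧
    (∀ Y, IsEvansFrame (W.scalarSystem lam) Y → evansDet Y ≠ 0) ∧
    (∀ ν v Y, IsNormalizedEvansFrame (W.scalarSystem lam)
      (ShockProfile.endStateSystem γ μ (√2) s W.Pm W.Jm lam)
      (ShockProfile.endStateSystem γ μ (√2) s W.Pp W.Jp lam) ν v Y → evansDet Y ≠ 0) ∧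
    ¬ W.IsEigenvalue lam := by
  have hk : √(2 : ℝ) ≠ 0 := by positivity
  have hδ0 : 0 ≤ W.deltaConst (Set.Ici 0) C := Real.sqrt_nonneg _
  obtain ⟨L, V, c, hVL, hq⟩ := W.exists_isLyapunovForm_scalarSystem hμ hμ2 hC (by linarith)
    (by linarith) hre hlam
  obtain ⟨K, hM⟩ := W.isBoundedSystem_scalarSystem hk lam
  obtain ⟨hbot, htop⟩ := finrank_decaySpace_of_modeForm hVL hM hq
  refine ⟨exists_isEvansFrame hbot htop, fun Y hY => ?_, fun ν v Y hY => ?_, fun h => ?_⟩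
  · obtain ⟨⟨h₀, h₁⟩, h₂, h₃⟩ := hY.mem_decaySpace
    exact hq.evansDet_ne_zero hM h₀ h₁ h₂ h₃ hY.linearIndependent_bot hY.linearIndependent_top
  · have hbotmem : ∀ i ∈ ({0, 1} : Set (Fin 4)), Y i ∈ decaySpace (W.scalarSystem lam) atBot :=
      fun i hi => ⟨hY.solution i, tendsto_zero_of_exp_smul (hY.tendsto_bot i hi)
        (tendsto_id.const_mul_atBot (hY.eigen_bot i hi).2)⟩
    have htopmem : ∀ i ∈ ({2, 3} : Set (Fin 4)), Y i ∈ decaySpace (W.scalarSystem lam) atTop :=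
      fun i hi => ⟨hY.solution i, tendsto_zero_of_exp_smul (hY.tendsto_top i hi)
        (tendsto_id.const_mul_atTop_of_neg (hY.eigen_top i hi).2)⟩
    exact hq.evansDet_ne_zero hM (hbotmem 0 (by simp)) (hbotmem 1 (by simp))
      (htopmem 2 (by simp)) (htopmem 3 (by simp))
      (linearIndependent_of_exp_smul (Or.inr (eventually_le_atBot 0)) (hY.tendsto_bot 0 (by simp))
        (hY.tendsto_bot 1 (by simp)) hY.linearIndependent_bot)
      (linearIndependent_of_exp_smul (Or.inl (eventually_ge_atTop 0)) (hY.tendsto_top 2 (by simp))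
        (hY.tendsto_top 3 (by simp)) hY.linearIndependent_top)
  · have hlam0 : lam ≠ 0 := norm_pos_iff.1 (hC.trans_le hlam)
    obtain ⟨Y, hY0, h₁, h₂⟩ := h.exists_mem_decaySpace hk hlam0
    exact hY0 (hq.eq_zero_of_mem_of_mem h₁ h₂)
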